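/- **Setting.** A stochastic quadratic problem on $\mathbb{R}^d$ is given by the law of a random pair $(\mathbf H(\xi),\mathbf b(\xi))$ with $\mathbf H(\xi)$ symmetric positive semidefinite and both components integrable; $F(\mathbf w,\xi)=\frac12\mathbf w^\top\mathbf H(\xi)\mathbf w-\mathbf b(\xi)^\top\mathbf w$ and $f(\mathbf w)=\mathbb E_\xi F(\mathbf w,\xi)$. Let $\mathbf H=\sum_{i=1}^d\lambda_i\mathbf v_i\mathbf v_i^\top$ be positive semidefinite with $(\mathbf v_i)$ orthonormal and $\lambda_1\ge\dots\ge\lambda_d\ge 0$, and write $\mathbf w^{(i)}=\mathbf v_i^\top\mathbf w$. For $c>0$, let $\mathcal F_{c\mathbf 1,\mathbf H}$ be the class of problems with $\mathbb E\,\mathbf H(\xi)=\mathbf H$ for which $f$ has a minimizer $\mathbf w_*$ with $|\mathbf w_*^{(i)}|\le c$ for all $i$. For $\sigma\ge 0$, let $\mathcal F_0$ be the class of problems with $\mathrm{Var}_\xi(\nabla F(\mathbf w,\xi))\preceq\sigma^2\mathbf H$ for every $\mathbf w$. Let $\mathcal A_T$ be the class of all (possibly randomized) algorithms that observe $T$ i.i.d.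 copies of $(\mathbf H(\xi),\mathbf b(\xi))$ and produce iterates $\hat{\mathbf w}_1,\dots,\hat{\mathbf w}_T$, where $\hat{\mathbf w}_t$ is a measurable function of the initial point, the previous iterates, the first $t$ observations and a random seed; the seeds are independent of the observations. Put $$\mathcal M_T(\mathbf H,c,\sigma)=\inf_{A\in\mathcal A_T}\ \sup_{\mathcal F_{c\mathbf 1,\mathbf H}\cap\mathcal F_0}\Big(\mathbb E f(\hat{\mathbf w}_T)-\inf_{\mathbf w} f(\mathbf w)\Big).$$ Vanilla SGD with exponentially decaying step size is $\mathbf w_{t+1}=\mathbf w_t-\eta_t(\mathbf H(\xi_t)\mathbf w_t-\mathbf b(\xi_t))$ for $0\le t<T$, with $\mathbf w_0=\mathbf 0$ and i.i.d. $\xi_t$, where $\eta_t=\eta_0/4^{\ell-1}$ for $K(\ell-1)\le t<K\ell$, $1\le\ell\le n$, with $n=\lfloor\log_2T\rfloor$ and $K=T/n$. Its output is $\mathbf w_T$. For $\theta\ge0$ let $k(\theta)=\max\{k:\lambda_k\ge\theta\}$ (and $0$ if there is no such $k$), $k^*=k(1/T)$ and $k_1^*=k\big(\sigma^2/(Tc^2)\big)$.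 **Theorem.** 1. (Upper bound.) For all $c,\eta_0>0$ there is a constant $C>0$ depending only on $c$ and $\eta_0$ such that, for all $d$, all $\mathbf H$ with $\eta_0\lambda_1\le 1$, all $\sigma\ge 0$, all $T\ge 16$ and every problem in $\mathcal F_{c\mathbf 1,\mathbf H}$ whose gradient noise $\zeta_t=\nabla F(\mathbf w_t,\xi_t)-\nabla f(\mathbf w_t)$ along the SGD run satisfies $\mathbb E[\zeta_t\zeta_t^\top\mid\mathbf w_t]\preceq\sigma^2\mathbf H$ almost surely for all $t<T$, $$\mathbb E f(\mathbf w_T)-\inf_{\mathbf w} f(\mathbf w)\le C(1+\sigma^2)\Big(\frac{k^*(\log_2T)^4}{T}+(\log_2T)^2\sum_{j>k^*}\lambda_jc^2\Big).$$ 2. (Lower bound.) For all $c>0$, $\sigma\ge0$, $d$, $T\ge1$ and all positive semidefinite $\mathbf H$, $$\mathcal M_T(\mathbf H,c,\sigma)\ge\frac18\Big(\frac{k_1^*\sigma^2}{T}+\sum_{j>k_1^*}\lambda_jc^2\Big).$$ 3. (Instance optimality.) For all $c,\sigma,\eta_0>0$ there is a constant $C>0$ depending only on $c,\sigma,\eta_0$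 such that, for all $d$, all $\mathbf H$ with $\eta_0\lambda_1\le1$ and all $T\ge16$, SGD satisfies $$\sup_{\mathcal F_{c\mathbf 1,\mathbf H}\cap\mathcal F_0}\Big(\mathbb E f(\mathbf w_T)-\inf_{\mathbf w} f(\mathbf w)\Big)\le C(\log_2T)^4\,\mathcal M_T(\mathbf H,c,\sigma).$$ -/

import Mathlib

open MeasureTheory
open scoped ENNReal

namespace StochQuad

/-- `ℝ^d` with its Euclidean structure. -/
abbrev E (d : ℕ) : Type := EuclideanSpace ℝ (Fin d)

instance matrixMeasurableSpace (d : ℕ) : MeasurableSpace (Matrix (Fin d) (Fin d) ℝ) :=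
  inferInstanceAs (MeasurableSpace (Fin d → Fin d → ℝ))

/-- One data point `(H(ξ), b(ξ))`. -/
abbrev Obs (d : ℕ) : Type := Matrix (Fin d) (Fin d) ℝ × E d

/-- Multiplication of a vector of `ℝ^d` by a matrix. -/
def mulE {d : ℕ} (A : Matrix (Fin d) (Fin d) ℝ) (w : E d) : E d :=
  WithLp.toLp 2 (A.mulVec w.ofLp)

/-- The individual function `F(w, ξ) = ½ wᵀ H(ξ) w - b(ξ)ᵀ w`. -/
noncomputable def individual {d : ℕ} (w : E d) (z : Obs d) : ℝ :=
  (1 / 2) * inner ℝ w (mulE z.1 w) - inner ℝ z.2 w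

/-- The stochastic gradient `∇F(w, ξ) = H(ξ) w - b(ξ)`. -/
def stochGrad {d : ℕ} (w : E d) (z : Obs d) : E d :=
  mulE z.1 w - z.2

/-- The objective `f(w) = E_ξ F(w, ξ)`; a problem is given by the law `μ` of `(H(ξ), b(ξ))`. -/
noncomputable def objective {d : ℕ} (μ : Measure (Obs d)) (w : E d) : ℝ :=
  ∫ z, individual w z ∂μ

/-- The class of problems whose objective has Hessian `H` and whose optimum `w_*` has
coordinates bounded by `|w_*^{(i)}| ≤ wbar i` in the basis `v`
(an eigenbasis of `H` in all uses below). -/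
structure InOptimumClass {d : ℕ} (H : Matrix (Fin d) (Fin d) ℝ)
    (v : OrthonormalBasis (Fin d) ℝ (E d)) (wbar : Fin d → ℝ) (μ : Measure (Obs d)) : Prop where
  isProbability : IsProbabilityMeasure μ
  posSemidef : ∀ᵐ z ∂μ, z.1.PosSemidef
  integrable_hess : ∀ i j, Integrable (fun z : Obs d => z.1 i j) μ
  integrable_lin : Integrable (fun z : Obs d => z.2) μ
  mean_hess : ∀ i j, ∫ z, z.1 i j ∂μ = H i j
  optimum : ∃ wStar : E d, (∀ w, objective μ wStar ≤ objective μ w) ∧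
    ∀ i, |inner ℝ (v i) wStar| ≤ wbar i

/-- `Var(∇F(w, ξ)) ≼ σ² H` at the point `w`: the variance of `uᵀ ∇F(w, ξ)` is at most `σ² uᵀ H u`
for every vector `u` (in particular it is finite). -/
def NoiseBoundAt {d : ℕ} (H : Matrix (Fin d) (Fin d) ℝ) (σ : ℝ) (μ : Measure (Obs d))
    (w : E d) : Prop :=
  ∀ u : E d,
    ∫⁻ z, ENNReal.ofReal ((inner ℝ u (stochGrad w z - ∫ z', stochGrad w z' ∂μ)) ^ 2) ∂μ ≤
      ENNReal.ofReal (σ ^ 2 * inner ℝ u (mulE H u))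

/-- The class of problems with `Var(∇F(·, ξ)) ≼ σ² H`. -/
def InNoiseClass {d : ℕ} (H : Matrix (Fin d) (Fin d) ℝ) (σ : ℝ) (μ : Measure (Obs d)) : Prop :=
  ∀ w : E d, NoiseBoundAt H σ μ w

/-- The intersection of the two classes of problems. -/
def problemClass {d : ℕ} (H : Matrix (Fin d) (Fin d) ℝ)
    (v : OrthonormalBasis (Fin d) ℝ (E d)) (wbar : Fin d → ℝ) (σ : ℝ) : Set (Measure (Obs d)) :=
  {μ | InOptimumClass H v wbar μ ∧ InNoiseClass H σ μ}

/-- A (possibly randomized) algorithm with `T` observations. Step number `t + 1` is a measurable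
function of the seed of that step, the observations `0, …, t` and the iterates
`w₀, ŵ₁, …, ŵ_t`. The seeds have an arbitrary joint law and are independent of the
observations. -/
structure Algorithm (d T : ℕ) where
  seedLaw : Measure (Fin T → E d)
  isProbability : IsProbabilityMeasure seedLaw
  init : E d
  step : (t : Fin T) → E d × (Fin (t + 1) → Obs d) × (Fin (t + 1) → E d) → E d
  measurable_step : ∀ t, Measurable (step t)

namespace Algorithm

variable {d T : ℕ}

/-- The iterates `w₀, ŵ₁, …, ŵ_t` for the seeds `s` and the observations `x`. -/
def history (A : Algorithm d T) (s : Fin T → E d) (x : Fin T → Obs d) :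
    (t : ℕ) → t ≤ T → (Fin (t + 1) → E d)
  | 0, _ => fun _ => A.init
  | t + 1, h => Fin.snoc (α := fun _ => E d) (history A s x t (Nat.le_of_succ_le h))
      (A.step ⟨t, h⟩ (s ⟨t, h⟩, fun i => x ⟨i, i.isLt.trans_le h⟩,
        history A s x t (Nat.le_of_succ_le h)))

/-- The iterate number `t`. -/
def iterate (A : Algorithm d T) (s : Fin T → E d) (x : Fin T → Obs d) (t : ℕ) (h : t ≤ T) : E d :=
  A.history s x t h (Fin.last t)

/-- The output `ŵ_T`. -/
def output (A : Algorithm d T) (s : Fin T → E d) (x : Fin T → Obs d) : E d :=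
  A.iterate s x T le_rfl

/-- The joint law of the seeds and of `T` i.i.d. observations with law `μ`. -/
noncomputable def jointLaw (A : Algorithm d T) (μ : Measure (Obs d)) :
    Measure ((Fin T → E d) × (Fin T → Obs d)) :=
  A.seedLaw.prod (Measure.pi fun _ : Fin T => μ)

/-- The error `E[f(ŵ_T)] - inf_w f(w)`, as the expectation of the nonnegative quantity
`f(ŵ_T) - inf_w f(w)` (it may be `∞`). -/
noncomputable def excessRisk (A : Algorithm d T) (μ : Measure (Obs d)) : ℝ≥0∞ :=
  ∫⁻ p, ENNReal.ofReal (objective μ (A.output p.1 p.2) - ⨅ w, objective μ w) ∂(A.jointLaw μ)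

/-- Anisotropic gradient noise along the run of the algorithm:
`E[ζ_t ζ_tᵀ | ŵ_t] ≼ σ² H` almost surely for all `t < T`, where
`ζ_t = ∇F(ŵ_t, ξ_t) - ∇f(ŵ_t)`. As `ξ_t` is independent of `ŵ_t`, this conditional expectation is
the variance matrix of `∇F(w, ξ)` at `w = ŵ_t`. -/
def GradientNoise (A : Algorithm d T) (H : Matrix (Fin d) (Fin d) ℝ) (σ : ℝ)
    (μ : Measure (Obs d)) : Prop :=
  ∀ (t : ℕ) (h : t < T), ∀ᵐ p ∂(A.jointLaw μ), NoiseBoundAt H σ μ (A.iterate p.1 p.2 t h.le)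

end Algorithm

/-- The min-max error over a class of problems, given `T` observations. -/
noncomputable def minimaxRisk {d : ℕ} (T : ℕ) (P : Set (Measure (Obs d))) : ℝ≥0∞ :=
  ⨅ A : Algorithm d T, ⨆ μ ∈ P, A.excessRisk μ

/-- The step size `η_t = η₀ / 4^(ℓ-1)` for `K (ℓ-1) ≤ t < K ℓ`, with `n = ⌊log₂ T⌋` stages of
(possibly fractional) length `K = T / n`, i.e. `ℓ - 1 = ⌊t n / T⌋`. -/
noncomputable def stepSize (η₀ : ℝ) (T t : ℕ) : ℝ :=
  η₀ / 4 ^ (t * Nat.log 2 T / T)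

/-- One SGD step is a measurable function of the observation and the current iterate. -/
theorem measurable_sgdStep {d : ℕ} (η : ℝ) :
    Measurable (fun p : Obs d × E d => p.2 - η • stochGrad p.2 p.1) := by
  have h : Measurable (fun p : Obs d × E d => mulE p.1.1 p.2) := by
    refine (WithLp.measurable_toLp 2 (Fin d → ℝ)).comp (measurable_pi_lambda _ fun i => ?_)
    simp only [Matrix.mulVec, dotProduct]
    refine Finset.measurable_sum _ fun j _ => ?_
    have h1 : Measurable (fun p : Obs d × E d => p.1.1 i j) :=
      (measurable_pi_apply j).comp
        ((measurable_pi_apply i).comp (measurable_fst.comp measurable_fst))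
    have h2 : Measurable (fun p : Obs d × E d => p.2.ofLp j) :=
      (measurable_pi_apply j).comp
        ((WithLp.measurable_ofLp 2 (Fin d → ℝ)).comp measurable_snd)
    exact h1.mul h2
  exact measurable_snd.sub ((h.sub (measurable_snd.comp measurable_fst)).const_smul η)

/-- Vanilla SGD `w_{t+1} = w_t - η_t (H(ξ_t) w_t - b(ξ_t))` from `w₀ = 0` with the exponentially
decaying step size schedule. It uses no seeds. -/
noncomputable def sgd (d T : ℕ) (η₀ : ℝ) : Algorithm d T where
  seedLaw := Measure.dirac 0
  isProbability := inferInstance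
  init := 0
  step := fun t p => p.2.2 (Fin.last t) -
    stepSize η₀ T t • stochGrad (p.2.2 (Fin.last t)) (p.2.1 (Fin.last t))
  measurable_step := fun t => by
    have h : Measurable (fun p : E d × (Fin ((t : ℕ) + 1) → Obs d) × (Fin ((t : ℕ) + 1) → E d) =>
        (p.2.1 (Fin.last t), p.2.2 (Fin.last t))) :=
      ((measurable_pi_apply (Fin.last (t : ℕ))).comp
        (measurable_fst.comp measurable_snd)).prodMk
      ((measurable_pi_apply (Fin.last (t : ℕ))).comp (measurable_snd.comp measurable_snd))
    exact (measurable_sgdStep (stepSize η₀ T t)).comp h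

/-- The iterates of `sgd` follow the SGD recursion. -/
theorem sgd_iterate_succ {d T : ℕ} (η₀ : ℝ) (s : Fin T → E d) (x : Fin T → Obs d) (t : ℕ)
    (h : t < T) :
    (sgd d T η₀).iterate s x (t + 1) h =
      (sgd d T η₀).iterate s x t h.le -
        stepSize η₀ T t • stochGrad ((sgd d T η₀).iterate s x t h.le) (x ⟨t, h⟩) := by
  simp only [Algorithm.iterate, Algorithm.history, Fin.snoc_last]
  rfl

/-- `max {k : λ_k ≥ θ}` for `λ_1 ≥ … ≥ λ_d` (and `0` if there is no such `k`). The `1`-based index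
of `i : Fin d` is `i + 1`. -/
noncomputable def effDim {d : ℕ} (lam : Fin d → ℝ) (θ : ℝ) : ℕ :=
  (Finset.univ.filter fun i : Fin d => θ ≤ lam i).sup fun i => (i : ℕ) + 1

/-- `∑_{j > k} λ_j` with `1`-based `j`. -/
noncomputable def tailSum {d : ℕ} (lam : Fin d → ℝ) (k : ℕ) : ℝ :=
  ∑ i ∈ Finset.univ.filter (fun i : Fin d => k < (i : ℕ) + 1), lam i

/-- An eigendecomposition `H = ∑ λ_i v_i v_iᵀ` of a positive semidefinite matrix, with
`λ_1 ≥ … ≥ λ_d`. -/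
structure IsEigenDecomposition {d : ℕ} (H : Matrix (Fin d) (Fin d) ℝ)
    (v : OrthonormalBasis (Fin d) ℝ (E d)) (lam : Fin d → ℝ) : Prop where
  posSemidef : H.PosSemidef
  eigen : ∀ i, mulE H (v i) = lam i • v i
  antitone : Antitone lam

end StochQuad

/-! The excess risk of a quadratic is `1/2 ∑ λ_i ⟨v_i, w - w_*⟩²`, so both bounds are proved one
eigendirection at a time, and an expression "effective dimension plus tail" is a sum whose `i`-th
term is a head or a tail value.

Upper bound. Along `v_i` the stochastic gradient has mean `λ_i` times the error and noise variance
at most `σ² λ_i`, so the second moments obey uncoupled scalar recursions `m_{t+1} ≤ (1 - λ_i η_t)²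
m_t + σ² λ_i η_t²` (`sgd_moment_le`). The first stage, about `T / log T` steps of size `η₀`, forgets
the starting point (`lam_mul_prod_contraction_le`). Noise injected before the last stage is damped
over the next stage length, where the step size shrinks at most by 4; in the last stage the step
size is at most `η₀ / T`, so the noise is already negligible (`noise_contribution_le`). When `λ_i ≤
1/T` no contraction is needed.

Lower bound. Take the Hessian deterministic and let `b` have independent coordinates `± σ √λ_i`
whose biases `± ρ_i` encode the signs of the coordinates `± δ_i` of the optimum. If `ρ_i² ≤ 1/(2T)`,
the squared Hellinger affinity of `T` draws under opposite signs is `(1 - ρ_i²)^T ≥ 1/2`, so no rule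
can tell the signs apart (`two_point_bound`). Averaging over all sign vectors adds these losses
(`assouad`, `le_minimaxRisk_of_signed`).

Optimality follows because the thresholds `1/T` and `σ²/(Tc²)` differ by a factor depending only on
`c` and `σ` (`sgdRate_le_minimaxRate`). -/

namespace StochQuad

/-! ### Effective dimension and tail as coordinatewise sums -/

section EffectiveDimension

variable {d : ℕ} {lam : Fin d → ℝ} {θ : ℝ}

/-- By monotonicity the indices above the threshold form an initial segment, and `effDim` is its
length; the strict inequality accounts for 0-based indices. -/
theorem lt_effDim_iff (h : Antitone lam) (i : Fin d) : (i : ℕ) < effDim lam θ ↔ θ ≤ lam i := by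
  simp only [effDim, Finset.lt_sup_iff, Finset.mem_filter, Finset.mem_univ, true_and]
  constructor
  · rintro ⟨j, hj, hij⟩
    exact hj.trans (h (Fin.le_def.2 (Nat.lt_succ_iff.1 hij)))
  · exact fun hi => ⟨i, hi, Nat.lt_succ_self _⟩

theorem effDim_le : effDim lam θ ≤ d :=
  Finset.sup_le fun i _ => i.isLt

/-- The effective dimension and the tail sum as one sum over all coordinates. -/
theorem effDim_mul_add_tailSum_mul (h : Antitone lam) (x y : ℝ) :
    effDim lam θ * x + tailSum lam (effDim lam θ) * y =
      ∑ i, if θ ≤ lam i then x else lam i * y := by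
  rw [Finset.sum_ite, Finset.sum_const, nsmul_eq_mul, tailSum, Finset.sum_mul]
  have hf : (Finset.univ.filter fun i : Fin d => θ ≤ lam i) =
      Finset.univ.filter fun i : Fin d => (i : ℕ) < effDim lam θ :=
    Finset.filter_congr fun i _ => (lt_effDim_iff h i).symm
  congr 2
  · rw [hf, Fin.card_filter_val_lt, min_eq_right effDim_le]
  · refine Finset.filter_congr fun i _ => ?_
    rw [← lt_effDim_iff h i]
    omega

end EffectiveDimension

/-! ### The quadratic objective and its diagonalization -/

section Objective

variable {d : ℕ} {H : Matrix (Fin d) (Fin d) ℝ} {v : OrthonormalBasis (Fin d) ℝ (E d)}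
  {lam : Fin d → ℝ} {μ : Measure (Obs d)}

theorem mulE_add (A : Matrix (Fin d) (Fin d) ℝ) (u w : E d) :
    mulE A (u + w) = mulE A u + mulE A w := by
  ext i; simp [mulE, Matrix.mulVec_add]

theorem mulE_smul (A : Matrix (Fin d) (Fin d) ℝ) (r : ℝ) (w : E d) :
    mulE A (r • w) = r • mulE A w := by
  ext i; simp [mulE, Matrix.mulVec_smul]

/-- Multiplication by a matrix as a linear map of the Euclidean space. -/
def mulELin (A : Matrix (Fin d) (Fin d) ℝ) : E d →ₗ[ℝ] E d where
  toFun := mulE A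
  map_add' := mulE_add A
  map_smul' := mulE_smul A

theorem mulE_sub (A : Matrix (Fin d) (Fin d) ℝ) (u w : E d) :
    mulE A (u - w) = mulE A u - mulE A w :=
  map_sub (mulELin A) u w

theorem inner_mulE (A : Matrix (Fin d) (Fin d) ℝ) (u w : E d) :
    inner ℝ u (mulE A w) = ∑ i, ∑ j, u i * w j * A i j := by
  simp only [mulE, PiLp.inner_apply, RCLike.inner_apply, Matrix.mulVec, dotProduct,
    Finset.sum_mul, conj_trivial]
  refine Finset.sum_congr rfl fun i _ => Finset.sum_congr rfl fun j _ => ?_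
  ring

namespace IsEigenDecomposition

variable (h : IsEigenDecomposition H v lam)
include h

theorem inner_mulE_comm (u w : E d) : inner ℝ u (mulE H w) = inner ℝ w (mulE H u) := by
  rw [inner_mulE, inner_mulE, Finset.sum_comm]
  refine Finset.sum_congr rfl fun i _ => Finset.sum_congr rfl fun j _ => ?_
  have := h.posSemidef.isHermitian.apply i j
  simp only [star_trivial] at this
  rw [this]; ring

theorem inner_eigen (i : Fin d) (w : E d) : inner ℝ (v i) (mulE H w) = lam i * inner ℝ (v i) w := by
  rw [h.inner_mulE_comm, h.eigen, inner_smul_right, real_inner_comm]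

theorem quadratic_eq_sum (u : E d) :
    inner ℝ u (mulE H u) = ∑ i, lam i * inner ℝ (v i) u ^ 2 := by
  rw [← v.sum_inner_mul_inner]
  refine Finset.sum_congr rfl fun i _ => ?_
  rw [h.inner_eigen, real_inner_comm]; ring

theorem lam_nonneg (i : Fin d) : 0 ≤ lam i := by
  have h1 : 0 ≤ inner ℝ (v i) (mulE H (v i)) := by
    have := h.posSemidef.dotProduct_mulVec_nonneg (v i).ofLp
    simpa [mulE, PiLp.inner_apply, dotProduct, mul_comm] using this
  rwa [h.inner_eigen, real_inner_self_eq_norm_sq, v.norm_eq_one, one_pow, mul_one] at h1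

end IsEigenDecomposition

theorem integrable_mulE (hi : ∀ i j, Integrable (fun z : Obs d => z.1 i j) μ) (w : E d) :
    Integrable (fun z : Obs d => mulE z.1 w) μ := by
  rw [← (PiLp.continuousLinearEquiv 2 ℝ fun _ : Fin d => ℝ).integrable_comp_iff]
  refine Integrable.of_eval fun i => ?_
  change Integrable (fun z : Obs d => ∑ j, z.1 i j * w j) μ
  exact integrable_finsetSum _ fun j _ => (hi i j).mul_const _

theorem integral_mulE (hi : ∀ i j, Integrable (fun z : Obs d => z.1 i j) μ)
    (hH : ∀ i j, ∫ z, z.1 i j ∂μ = H i j) (w : E d) :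
    ∫ z : Obs d, mulE z.1 w ∂μ = mulE H w := by
  refine ext_inner_left ℝ fun u => ?_
  rw [← integral_inner (integrable_mulE hi w)]
  simp only [inner_mulE]
  rw [integral_finsetSum _ fun i _ => integrable_finsetSum _ fun j _ => (hi i j).const_mul _]
  refine Finset.sum_congr rfl fun i _ => ?_
  rw [integral_finsetSum _ fun j _ => (hi i j).const_mul _]
  refine Finset.sum_congr rfl fun j _ => ?_
  rw [integral_const_mul, hH]

theorem objective_eq (hi : ∀ i j, Integrable (fun z : Obs d => z.1 i j) μ)
    (hb : Integrable (fun z : Obs d => z.2) μ)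
    (hH : ∀ i j, ∫ z, z.1 i j ∂μ = H i j) (w : E d) :
    objective μ w = 1 / 2 * inner ℝ w (mulE H w) - inner ℝ w (∫ z, z.2 ∂μ) := by
  have h1 := (integrable_mulE hi w).const_inner (𝕜 := ℝ) w
  have h2 := hb.const_inner (𝕜 := ℝ) w
  simp only [objective, individual, real_inner_comm w]
  rw [integral_sub (h1.const_mul _) h2, integral_const_mul, integral_inner hb,
    integral_inner (integrable_mulE hi w), integral_mulE hi hH]

theorem objective_sub_of_stationary (h : IsEigenDecomposition H v lam)
    (hi : ∀ i j, Integrable (fun z : Obs d => z.1 i j) μ)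
    (hb : Integrable (fun z : Obs d => z.2) μ)
    (hH : ∀ i j, ∫ z, z.1 i j ∂μ = H i j) {wStar : E d} (hs : mulE H wStar = ∫ z, z.2 ∂μ)
    (w : E d) :
    objective μ w - objective μ wStar = 1 / 2 * ∑ i, lam i * inner ℝ (v i) (w - wStar) ^ 2 := by
  rw [objective_eq hi hb hH, objective_eq hi hb hH, ← h.quadratic_eq_sum, ← hs, mulE_sub,
    inner_sub_left, inner_sub_right, inner_sub_right, h.inner_mulE_comm wStar w]
  ring

theorem objective_le_of_stationary (h : IsEigenDecomposition H v lam)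
    (hi : ∀ i j, Integrable (fun z : Obs d => z.1 i j) μ)
    (hb : Integrable (fun z : Obs d => z.2) μ)
    (hH : ∀ i j, ∫ z, z.1 i j ∂μ = H i j) {wStar : E d} (hs : mulE H wStar = ∫ z, z.2 ∂μ)
    (w : E d) : objective μ wStar ≤ objective μ w := by
  rw [← sub_nonneg, objective_sub_of_stationary h hi hb hH hs]
  exact mul_nonneg (by norm_num) (Finset.sum_nonneg fun i _ => mul_nonneg (h.lam_nonneg i) (sq_nonneg _))

/-- Along each line through the minimizer, the increment of `f` is a nonnegative quadratic in `t`
with zero constant term. Its discriminant is then `g ^ 2`, which forces the slope `g` to vanish. No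
inverse of `H` is involved, so singular Hessians are covered. -/
theorem stationary_of_objective_le (h : IsEigenDecomposition H v lam)
    (hi : ∀ i j, Integrable (fun z : Obs d => z.1 i j) μ)
    (hb : Integrable (fun z : Obs d => z.2) μ)
    (hH : ∀ i j, ∫ z, z.1 i j ∂μ = H i j) {wStar : E d}
    (hs : ∀ w, objective μ wStar ≤ objective μ w) : mulE H wStar = ∫ z, z.2 ∂μ := by
  refine ext_inner_left ℝ fun u => ?_
  set g := inner ℝ u (mulE H wStar) - inner ℝ u (∫ z, z.2 ∂μ) with hg
  set q := inner ℝ u (mulE H u) with hq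
  have key : ∀ t : ℝ, 0 ≤ 1 / 2 * q * (t * t) + g * t + 0 := fun t => by
    have h1 := hs (wStar + t • u)
    rw [objective_eq hi hb hH, objective_eq hi hb hH, mulE_add, mulE_smul] at h1
    simp only [inner_add_left, inner_add_right, inner_smul_left, inner_smul_right,
      conj_trivial] at h1
    rw [h.inner_mulE_comm wStar u] at h1
    rw [hg, hq]
    nlinarith
  have hd := discrim_le_zero key
  have hg0 : g = 0 := by
    rw [discrim] at hd
    nlinarith [sq_nonneg g]
  rw [hg] at hg0
  linarith

/-- This decouples the risk into eigendirections; the real infimum is meaningful because it is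
attained at the stationary point. -/
theorem objective_sub_iInf (h : IsEigenDecomposition H v lam)
    (hi : ∀ i j, Integrable (fun z : Obs d => z.1 i j) μ)
    (hb : Integrable (fun z : Obs d => z.2) μ)
    (hH : ∀ i j, ∫ z, z.1 i j ∂μ = H i j) {wStar : E d} (hs : mulE H wStar = ∫ z, z.2 ∂μ)
    (w : E d) :
    objective μ w - ⨅ w', objective μ w' =
      1 / 2 * ∑ i, lam i * inner ℝ (v i) (w - wStar) ^ 2 := by
  have hinf : ⨅ w', objective μ w' = objective μ wStar :=
    le_antisymm (ciInf_le ⟨objective μ wStar, by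
      rintro _ ⟨w', rfl⟩; exact objective_le_of_stationary h hi hb hH hs w'⟩ wStar)
      (le_ciInf (objective_le_of_stationary h hi hb hH hs))
  rw [hinf, objective_sub_of_stationary h hi hb hH hs]

end Objective

/-! ### Scalar estimates for the decaying step size -/

section StepSize

theorem mul_exp_neg_le_one (u : ℝ) : u * Real.exp (-u) ≤ 1 := by
  rw [Real.exp_neg, ← div_eq_mul_inv, div_le_one (Real.exp_pos u)]
  linarith [Real.add_one_le_exp u]

theorem sq_mul_exp_neg_le_two {u : ℝ} (hu : 0 ≤ u) : u ^ 2 * Real.exp (-u) ≤ 2 := by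
  rw [Real.exp_neg, ← div_eq_mul_inv, div_le_iff₀ (Real.exp_pos u)]
  linarith [Real.quadratic_le_exp_of_nonneg hu]

theorem one_sub_pow_le_exp {y : ℝ} (hy : y ≤ 1) (m : ℕ) : (1 - y) ^ m ≤ Real.exp (-(m * y)) := by
  calc (1 - y) ^ m ≤ Real.exp (-y) ^ m :=
        pow_le_pow_left₀ (by linarith) (Real.one_sub_le_exp_neg y) m
    _ = Real.exp (-(m * y)) := by rw [← Real.exp_nat_mul]; ring_nf

variable {η₀ lam : ℝ} {T : ℕ}

theorem stepSize_nonneg (hη : 0 ≤ η₀) (t : ℕ) : 0 ≤ stepSize η₀ T t :=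
  div_nonneg hη (by positivity)

theorem stepSize_le (hη : 0 ≤ η₀) (t : ℕ) : stepSize η₀ T t ≤ η₀ :=
  div_le_self hη (one_le_pow₀ (by norm_num))

theorem lam_mul_stepSize_nonneg (hη : 0 ≤ η₀) (hl : 0 ≤ lam) (t : ℕ) :
    0 ≤ lam * stepSize η₀ T t :=
  mul_nonneg hl (stepSize_nonneg hη t)

theorem lam_mul_stepSize_le (hη : 0 ≤ η₀) (hl : 0 ≤ lam) (t : ℕ) :
    lam * stepSize η₀ T t ≤ η₀ * lam := by
  rw [mul_comm]
  exact mul_le_mul_of_nonneg_right (stepSize_le hη t) hl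

/-- The squared contraction factor of step `t` in an eigendirection with eigenvalue `lam`. -/
noncomputable def contraction (η₀ lam : ℝ) (T t : ℕ) : ℝ :=
  (1 - lam * stepSize η₀ T t) ^ 2

theorem contraction_nonneg (t : ℕ) : 0 ≤ contraction η₀ lam T t := sq_nonneg _

theorem contraction_le_one (hη : 0 ≤ η₀) (hl : 0 ≤ lam) (h1 : η₀ * lam ≤ 1) (t : ℕ) :
    contraction η₀ lam T t ≤ 1 := by
  have h2 := lam_mul_stepSize_nonneg (T := T) hη hl t
  have h3 := lam_mul_stepSize_le (T := T) hη hl t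
  exact pow_le_one₀ (by linarith) (by linarith)

/-- The length of a stage, rounded down, is comparable to `T / log₂ T`. -/
theorem stage_length_pos (hT : 16 ≤ T) : 1 ≤ T / Nat.log 2 T := by
  have h := Nat.log_lt_self 2 (show T ≠ 0 by omega)
  have h0 : 0 < Nat.log 2 T := Nat.log_pos (by norm_num) (by omega)
  exact (Nat.one_le_div_iff h0).2 h.le

theorem le_two_mul_stage_length (hT : 16 ≤ T) :
    (T : ℝ) ≤ 2 * Nat.log 2 T * ((T / Nat.log 2 T : ℕ) : ℝ) := by
  have h0 : 0 < Nat.log 2 T := Nat.log_pos (by norm_num) (by omega)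
  have h1 := stage_length_pos hT
  have h2 := Nat.lt_mul_div_succ T h0
  have h3 : T ≤ 2 * Nat.log 2 T * (T / Nat.log 2 T) := by nlinarith
  exact_mod_cast h3

/-- Only the first `K` factors are used; the later ones are at most 1 and are dropped. -/
theorem prod_contraction_le_pow (hη : 0 ≤ η₀) (hl : 0 ≤ lam) (h1 : η₀ * lam ≤ 1)
    {a b K : ℕ} (hab : a + K ≤ b) {y : ℝ}
    (hy : ∀ s ∈ Finset.Ico a (a + K), y ≤ lam * stepSize η₀ T s) :
    ∏ s ∈ Finset.Ico a b, contraction η₀ lam T s ≤ (1 - y) ^ (2 * K) := by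
  rw [← Finset.prod_Ico_consecutive _ (Nat.le_add_right a K) hab]
  have hA : ∏ s ∈ Finset.Ico a (a + K), contraction η₀ lam T s ≤ (1 - y) ^ (2 * K) := by
    calc ∏ s ∈ Finset.Ico a (a + K), contraction η₀ lam T s
        ≤ ∏ _s ∈ Finset.Ico a (a + K), (1 - y) ^ 2 :=
          Finset.prod_le_prod (fun s _ => contraction_nonneg s) fun s hs => by
            have h2 := lam_mul_stepSize_le (T := T) hη hl s
            exact pow_le_pow_left₀ (by linarith) (by linarith [hy s hs]) 2
      _ = (1 - y) ^ (2 * K) := by simp [pow_mul]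
  have hB : ∏ s ∈ Finset.Ico (a + K) b, contraction η₀ lam T s ≤ 1 :=
    Finset.prod_le_one (fun s _ => contraction_nonneg s)
      fun s _ => contraction_le_one hη hl h1 s
  calc _ ≤ (∏ s ∈ Finset.Ico a (a + K), contraction η₀ lam T s) * 1 :=
        mul_le_mul_of_nonneg_left hB (Finset.prod_nonneg fun s _ => contraction_nonneg s)
    _ ≤ _ := by rwa [mul_one]

/-- The first stage alone contracts the initial error. -/
theorem lam_mul_prod_contraction_le (hη : 0 < η₀) (hl : 0 ≤ lam) (h1 : η₀ * lam ≤ 1)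
    (hT : 16 ≤ T) :
    lam * ∏ s ∈ Finset.Ico 0 T, contraction η₀ lam T s ≤ Nat.log 2 T / (η₀ * T) := by
  set n := Nat.log 2 T with hn
  set K := T / n with hK
  have hK1 : 1 ≤ K := stage_length_pos hT
  have hTK := le_two_mul_stage_length hT
  have hK0 : (0 : ℝ) < K := by exact_mod_cast hK1
  have hT0 : (0 : ℝ) < T := by positivity
  -- For `s < K` the stage index `s * n / T` is 0, so the step size is exactly `η₀`.
  have hp := prod_contraction_le_pow (T := T) (a := 0) (b := T) (K := K) (y := η₀ * lam)
    hη.le hl h1 (by rw [zero_add]; exact Nat.div_le_self _ _) fun s hs => by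
      have hsK : s < K := by simpa using hs
      have hlt : s * n < T := by
        calc s * n < K * n := Nat.mul_lt_mul_of_pos_right hsK (Nat.log_pos (by norm_num) (by omega))
          _ ≤ T := Nat.div_mul_le_self T n
      rw [stepSize, Nat.div_eq_of_lt hlt, pow_zero, div_one, mul_comm]
  have he := one_sub_pow_le_exp h1 (2 * K)
  have hu := mul_exp_neg_le_one (((2 * K : ℕ) : ℝ) * (η₀ * lam))
  rw [le_div_iff₀ (by positivity)]
  calc lam * (∏ s ∈ Finset.Ico 0 T, contraction η₀ lam T s) * (η₀ * T)
      ≤ lam * Real.exp (-(((2 * K : ℕ) : ℝ) * (η₀ * lam))) * (η₀ * (2 * n * K)) := by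
        gcongr
        exact hp.trans he
    _ = (((2 * K : ℕ) : ℝ) * (η₀ * lam)) * Real.exp (-(((2 * K : ℕ) : ℝ) * (η₀ * lam))) * n := by
        push_cast; ring
    _ ≤ 1 * n := by gcongr
    _ = n := one_mul _

/-- The noise injected in one step is forgotten by the end of the run, up to `O(log² T / T²)`. -/
theorem noise_contribution_le (hη : 0 < η₀) (hl : 0 ≤ lam) (h1 : η₀ * lam ≤ 1)
    (hT : 16 ≤ T) (t : ℕ) :
    (lam * stepSize η₀ T t) ^ 2 * ∏ s ∈ Finset.Ico (t + 1) T, contraction η₀ lam T s ≤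
      32 * Nat.log 2 T ^ 2 / T ^ 2 := by
  set n := Nat.log 2 T with hn
  set K := T / n with hK
  set x := lam * stepSize η₀ T t with hx
  have hn0 : 0 < n := Nat.log_pos (by norm_num) (by omega)
  have hK1 : 1 ≤ K := stage_length_pos hT
  have hTK := le_two_mul_stage_length hT
  have hK0 : (0 : ℝ) < K := by exact_mod_cast hK1
  have hT0 : (0 : ℝ) < T := by positivity
  have hx0 : 0 ≤ x := lam_mul_stepSize_nonneg hη.le hl t
  have hx1 : x ≤ 1 := (lam_mul_stepSize_le hη.le hl t).trans h1
  have hn1 : (1 : ℝ) ≤ n := by exact_mod_cast hn0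
  rw [le_div_iff₀ (by positivity)]
  by_cases hlast : t * n < (n - 1) * T
  -- Step `t` precedes the last stage: `K` more steps fit into the run, and during them the stage
  -- index rises by at most one, so `lam * η_s ≥ x / 4`.
  · have hKn : K * n ≤ T := Nat.div_mul_le_self T n
    have hfit : t + 1 + K ≤ T := by
      obtain ⟨m, hm⟩ : ∃ m, n = m + 1 := ⟨n - 1, by omega⟩
      have : (t + K) * n < T * n := by
        rw [hm] at hlast hKn ⊢
        rw [Nat.add_sub_cancel] at hlast
        nlinarith
      have := Nat.lt_of_mul_lt_mul_right this
      omega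
    have hp := prod_contraction_le_pow (T := T) (a := t + 1) (b := T) (K := K) (y := x / 4)
      hη.le hl h1 hfit fun s hs => by
        have hs' : s ≤ t + K := by have := (Finset.mem_Ico.1 hs).2; omega
        have hdiv : s * n / T ≤ t * n / T + 1 := by
          rw [← Nat.add_div_right _ (by omega : 0 < T)]
          refine Nat.div_le_div_right ?_
          nlinarith
        have hpow : (4 : ℝ) ^ (s * n / T) ≤ 4 ^ (t * n / T) * 4 := by
          rw [← pow_succ]; exact pow_le_pow_right₀ (by norm_num) hdiv
        rw [hx, mul_div_assoc, stepSize, stepSize, div_div]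
        gcongr
    have he := one_sub_pow_le_exp (show x / 4 ≤ 1 by linarith) (2 * K)
    have hu := sq_mul_exp_neg_le_two
      (show 0 ≤ ((2 * K : ℕ) : ℝ) * (x / 4) by positivity)
    calc x ^ 2 * (∏ s ∈ Finset.Ico (t + 1) T, contraction η₀ lam T s) * T ^ 2
        ≤ x ^ 2 * Real.exp (-(((2 * K : ℕ) : ℝ) * (x / 4))) * (2 * n * K) ^ 2 := by
          gcongr
          exact hp.trans he
      _ = ((((2 * K : ℕ) : ℝ) * (x / 4)) ^ 2 * Real.exp (-(((2 * K : ℕ) : ℝ) * (x / 4)))) *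
            (16 * n ^ 2) := by push_cast; ring
      _ ≤ 2 * (16 * n ^ 2) := by gcongr
      _ = 32 * n ^ 2 := by ring
  -- In the last stage the damping is ignored: `4 ^ (n - 1) ≥ T` already gives `x ≤ 1 / T`.
  · have hstage : n - 1 ≤ t * n / T := (Nat.le_div_iff_mul_le (by omega)).2 (not_lt.1 hlast)
    have hTn : T < 2 ^ (n + 1) := Nat.lt_pow_succ_log_self (by norm_num) T
    have h4 : (T : ℝ) ≤ 4 ^ (n - 1) := by
      -- From `T < 2 ^ (n + 1)`; dividing by `T ≥ 16` then leaves `T ≤ 4 ^ (n - 1)`.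
      have h5 : T * T ≤ 4 ^ (n - 1) * 16 := by
        have : 4 ^ (n - 1) * 16 = 2 ^ (n + 1) * 2 ^ (n + 1) := by
          obtain ⟨m, hm⟩ : ∃ m, n = m + 1 := ⟨n - 1, by omega⟩
          rw [hm, Nat.add_sub_cancel, ← mul_pow]; norm_num [pow_succ]; ring
        rw [this]; exact Nat.mul_le_mul hTn.le hTn.le
      have h6 : T ≤ 4 ^ (n - 1) := by nlinarith
      exact_mod_cast h6
    have hxT : x * T ≤ 1 := by
      rw [hx, stepSize, ← mul_div_assoc, div_mul_eq_mul_div, div_le_one (by positivity)]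
      calc lam * η₀ * T ≤ 1 * 4 ^ (n - 1) := by
            gcongr
            rwa [mul_comm]
        _ ≤ 4 ^ (t * n / T) := by
            rw [one_mul]; exact pow_le_pow_right₀ (by norm_num) hstage
    have hprod : ∏ s ∈ Finset.Ico (t + 1) T, contraction η₀ lam T s ≤ 1 :=
      Finset.prod_le_one (fun s _ => contraction_nonneg s)
        fun s _ => contraction_le_one hη.le hl h1 s
    calc x ^ 2 * (∏ s ∈ Finset.Ico (t + 1) T, contraction η₀ lam T s) * T ^ 2
        ≤ x ^ 2 * 1 * T ^ 2 := by gcongr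
      _ = (x * T) ^ 2 := by ring
      _ ≤ 1 := pow_le_one₀ (by positivity) hxT
      _ ≤ 32 * n ^ 2 := by nlinarith

/-- The solution of the second moment recursion
`m (t + 1) = (1 - lam η_t)² m t + σ² lam η_t²`, `m 0 = c²`. -/
noncomputable def momentBound (η₀ lam σ c : ℝ) (T t : ℕ) : ℝ :=
  c ^ 2 * ∏ s ∈ Finset.Ico 0 t, contraction η₀ lam T s +
    σ ^ 2 * lam * ∑ r ∈ Finset.range t, stepSize η₀ T r ^ 2 *
      ∏ s ∈ Finset.Ico (r + 1) t, contraction η₀ lam T s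

theorem momentBound_zero (σ c : ℝ) : momentBound η₀ lam σ c T 0 = c ^ 2 := by
  simp [momentBound]

theorem momentBound_succ (σ c : ℝ) (t : ℕ) :
    momentBound η₀ lam σ c T (t + 1) =
      contraction η₀ lam T t * momentBound η₀ lam σ c T t +
        stepSize η₀ T t ^ 2 * (σ ^ 2 * lam) := by
  have hS : ∑ r ∈ Finset.range t, stepSize η₀ T r ^ 2 *
      ∏ s ∈ Finset.Ico (r + 1) (t + 1), contraction η₀ lam T s =
      (∑ r ∈ Finset.range t, stepSize η₀ T r ^ 2 *
        ∏ s ∈ Finset.Ico (r + 1) t, contraction η₀ lam T s) * contraction η₀ lam T t := by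
    rw [Finset.sum_mul]
    refine Finset.sum_congr rfl fun r hr => ?_
    rw [Finset.prod_Ico_succ_top (Nat.succ_le_of_lt (Finset.mem_range.1 hr)), mul_assoc]
  rw [momentBound, momentBound, Finset.prod_Ico_succ_top (Nat.zero_le t), Finset.sum_range_succ,
    hS, Finset.Ico_self, Finset.prod_empty]
  ring

theorem momentBound_nonneg (hl : 0 ≤ lam) (σ c : ℝ) (t : ℕ) :
    0 ≤ momentBound η₀ lam σ c T t := by
  induction t with
  | zero => rw [momentBound_zero]; positivity
  | succ t ih =>
    rw [momentBound_succ]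
    have := contraction_nonneg (η₀ := η₀) (lam := lam) (T := T) t
    positivity

/-- Bias comes from the first-stage contraction; `T` noise terms of size `O(n² / T²)` sum to `O(n² /
T)`, uniformly in `lam`. -/
theorem lam_mul_momentBound_le_head (hη : 0 < η₀) (hl : 0 ≤ lam) (h1 : η₀ * lam ≤ 1)
    (hT : 16 ≤ T) (σ c : ℝ) :
    lam * momentBound η₀ lam σ c T T ≤
      c ^ 2 * (Nat.log 2 T / (η₀ * T)) + σ ^ 2 * (32 * Nat.log 2 T ^ 2 / T) := by
  have hT0 : (0 : ℝ) < T := by positivity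
  have hB := lam_mul_prod_contraction_le hη hl h1 hT
  have hV : ∑ r ∈ Finset.range T, (lam * stepSize η₀ T r) ^ 2 *
      ∏ s ∈ Finset.Ico (r + 1) T, contraction η₀ lam T s ≤ 32 * Nat.log 2 T ^ 2 / T := by
    calc _ ≤ ∑ _r ∈ Finset.range T, 32 * (Nat.log 2 T : ℝ) ^ 2 / T ^ 2 :=
          Finset.sum_le_sum fun r _ =>
            noise_contribution_le hη hl h1 hT r
      _ = 32 * Nat.log 2 T ^ 2 / T := by
          rw [Finset.sum_const, Finset.card_range, nsmul_eq_mul]; field_simp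
  calc lam * momentBound η₀ lam σ c T T
      = c ^ 2 * (lam * ∏ s ∈ Finset.Ico 0 T, contraction η₀ lam T s) +
        σ ^ 2 * ∑ r ∈ Finset.range T, (lam * stepSize η₀ T r) ^ 2 *
          ∏ s ∈ Finset.Ico (r + 1) T, contraction η₀ lam T s := by
        rw [momentBound, mul_add, Finset.mul_sum, Finset.mul_sum, Finset.mul_sum]
        congr 1
        · ring
        · exact Finset.sum_congr rfl fun r _ => by ring
    _ ≤ _ := by gcongr

/-- All contraction factors are bounded by 1. The noise adds up to at most `σ² lam T η₀²`, and `lam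
* T ≤ 1` absorbs the factor `T`. -/
theorem lam_mul_momentBound_le_tail (hη : 0 < η₀) (hl : 0 ≤ lam) (h1 : η₀ * lam ≤ 1)
    (hlT : lam * T ≤ 1) (σ c : ℝ) :
    lam * momentBound η₀ lam σ c T T ≤ lam * c ^ 2 + σ ^ 2 * (lam * η₀ ^ 2) := by
  have hprod : ∀ a, ∏ s ∈ Finset.Ico a T, contraction η₀ lam T s ≤ 1 := fun a =>
    Finset.prod_le_one (fun s _ => contraction_nonneg s)
      fun s _ => contraction_le_one hη.le hl h1 s
  have hV : ∑ r ∈ Finset.range T, stepSize η₀ T r ^ 2 *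
      ∏ s ∈ Finset.Ico (r + 1) T, contraction η₀ lam T s ≤ T * η₀ ^ 2 := by
    calc _ ≤ ∑ _r ∈ Finset.range T, η₀ ^ 2 * 1 := by
          refine Finset.sum_le_sum fun r _ => ?_
          exact mul_le_mul (pow_le_pow_left₀ (stepSize_nonneg hη.le r) (stepSize_le hη.le r) 2)
            (hprod _) (Finset.prod_nonneg fun s _ => contraction_nonneg s) (by positivity)
      _ = T * η₀ ^ 2 := by simp
  calc lam * momentBound η₀ lam σ c T T
      ≤ lam * (c ^ 2 * 1 + σ ^ 2 * lam * (T * η₀ ^ 2)) := by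
        rw [momentBound]
        have := hprod 0
        gcongr
    _ = lam * c ^ 2 + σ ^ 2 * (lam * η₀ ^ 2) * (lam * T) := by ring
    _ ≤ lam * c ^ 2 + σ ^ 2 * (lam * η₀ ^ 2) * 1 := by gcongr
    _ = _ := by ring

end StepSize

/-! ### One SGD step in an eigendirection -/

section OneStep

variable {d : ℕ} {H : Matrix (Fin d) (Fin d) ℝ} {v : OrthonormalBasis (Fin d) ℝ (E d)}
  {lam : Fin d → ℝ} {μ : Measure (Obs d)} {σ : ℝ}

/-- Bias-variance decomposition for a real random variable, as an upper bound. -/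
theorem lintegral_sq_sub_mul_le {Ω : Type*} [MeasurableSpace Ω] {P : Measure Ω}
    [IsProbabilityMeasure P] {X : Ω → ℝ} (hX : Integrable X P) (h0 : ∫ ω, X ω ∂P = 0)
    {s : ℝ} (hs : 0 ≤ s) (hv : ∫⁻ ω, ENNReal.ofReal (X ω ^ 2) ∂P ≤ ENNReal.ofReal s) (a η : ℝ) :
    ∫⁻ ω, ENNReal.ofReal ((a - η * X ω) ^ 2) ∂P ≤ ENNReal.ofReal (a ^ 2 + η ^ 2 * s) := by
  -- The extended-valued variance bound is finite, so square integrability need not be assumed.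
  have hX2 : Integrable (fun ω => X ω ^ 2) P := by
    refine ⟨hX.1.pow 2, ?_⟩
    rw [hasFiniteIntegral_iff_ofReal (Filter.Eventually.of_forall fun ω => sq_nonneg _)]
    exact hv.trans_lt ENNReal.ofReal_lt_top
  have hle : ∫ ω, X ω ^ 2 ∂P ≤ s := by
    rw [← ofReal_integral_eq_lintegral_ofReal hX2
      (Filter.Eventually.of_forall fun ω => sq_nonneg _)] at hv
    exact (ENNReal.ofReal_le_ofReal_iff hs).1 hv
  have hexp : ∀ ω, (a - η * X ω) ^ 2 = a ^ 2 - 2 * a * η * X ω + η ^ 2 * X ω ^ 2 := fun ω => by ring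
  have hi1 : Integrable (fun ω => a ^ 2 - 2 * a * η * X ω) P :=
    (integrable_const _).sub (hX.const_mul _)
  have hi : Integrable (fun ω => a ^ 2 - 2 * a * η * X ω + η ^ 2 * X ω ^ 2) P :=
    hi1.add (hX2.const_mul _)
  simp only [hexp]
  rw [← ofReal_integral_eq_lintegral_ofReal hi (Filter.Eventually.of_forall fun ω => by
    simp only [← hexp]; exact sq_nonneg _)]
  refine ENNReal.ofReal_le_ofReal ?_
  rw [integral_add hi1 (hX2.const_mul _), integral_sub (integrable_const _) (hX.const_mul _),
    integral_const_mul, integral_const_mul, h0]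
  simp only [integral_const, probReal_univ, smul_eq_mul, one_mul, mul_zero, sub_zero]
  gcongr

theorem measurable_mulE_fst (w : E d) : Measurable fun z : Obs d => mulE z.1 w := by
  -- With `b = 0` and step size 1 the SGD step is `w - A w`; subtracting it from `w` leaves `A w`.
  have h := (measurable_sgdStep (d := d) 1).comp
    ((measurable_fst.prodMk measurable_const).prodMk measurable_const :
      Measurable fun z : Obs d => (((z.1, 0), w) : Obs d × E d))
  have h2 := (measurable_const (a := w)).sub h
  convert h2 using 2
  simp [stochGrad]

/-- One SGD step in an eigendirection. -/
theorem lintegral_sgdStep_le [IsProbabilityMeasure μ] (h : IsEigenDecomposition H v lam)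
    (hi : ∀ i j, Integrable (fun z : Obs d => z.1 i j) μ)
    (hb : Integrable (fun z : Obs d => z.2) μ)
    (hH : ∀ i j, ∫ z, z.1 i j ∂μ = H i j) {wStar : E d} (hs : mulE H wStar = ∫ z, z.2 ∂μ)
    {w : E d} (hw : NoiseBoundAt H σ μ w) (η : ℝ) (i : Fin d) :
    ∫⁻ z, ENNReal.ofReal (inner ℝ (v i) (w - η • stochGrad w z - wStar) ^ 2) ∂μ ≤
      ENNReal.ofReal ((1 - lam i * η) ^ 2) * ENNReal.ofReal (inner ℝ (v i) (w - wStar) ^ 2) +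
        ENNReal.ofReal (η ^ 2 * (σ ^ 2 * lam i)) := by
  have hg : Integrable (fun z => stochGrad w z) μ := (integrable_mulE hi w).sub hb
  have hmean : ∫ z, stochGrad w z ∂μ = mulE H (w - wStar) := by
    simp only [stochGrad]
    rw [integral_sub (integrable_mulE hi w) hb, integral_mulE hi hH, ← hs, mulE_sub]
  have hX : Integrable (fun z => inner ℝ (v i) (stochGrad w z - ∫ z', stochGrad w z' ∂μ)) μ :=
    (hg.sub (integrable_const _)).const_inner _
  have hX0 : ∫ z, inner ℝ (v i) (stochGrad w z - ∫ z', stochGrad w z' ∂μ) ∂μ = 0 := by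
    rw [integral_inner (f := fun z => stochGrad w z - ∫ z', stochGrad w z' ∂μ)
      (hg.sub (integrable_const _)), integral_sub hg (integrable_const _)]
    simp
  have hvar := hw (v i)
  rw [h.inner_eigen, real_inner_self_eq_norm_sq, v.norm_eq_one, one_pow, mul_one] at hvar
  have hl := h.lam_nonneg i
  have key := lintegral_sq_sub_mul_le hX hX0 (by positivity) hvar
    ((1 - lam i * η) * inner ℝ (v i) (w - wStar)) η
  rw [← ENNReal.ofReal_mul (sq_nonneg _), ← ENNReal.ofReal_add (by positivity) (by positivity)]
  rw [mul_pow] at key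
  refine le_trans (lintegral_mono fun z => le_of_eq ?_) key
  congr 2
  -- The new error along `v i` is `(1 - lam i * η)` times the old one, minus `η` times the centred
  -- noise.
  rw [hmean, inner_sub_right (v i) (stochGrad w z), h.inner_eigen]
  simp only [inner_sub_right, inner_smul_right]
  ring

end OneStep

/-- Under a product of copies of one probability measure, resampling a coordinate does not change
the expectation. -/
theorem lintegral_pi_update {ι Ω : Type*} [Fintype ι] [DecidableEq ι] [MeasurableSpace Ω]
    (P : Measure Ω) [IsProbabilityMeasure P] {f : (ι → Ω) → ℝ≥0∞} (hf : Measurable f) (t : ι) :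
    ∫⁻ x, f x ∂(Measure.pi fun _ => P) =
      ∫⁻ x, ∫⁻ z, f (Function.update x t z) ∂P ∂(Measure.pi fun _ => P) := by
  have hg : (fun x => ∫⁻ z, f (Function.update x t z) ∂P) = ∫⋯∫⁻_{t}, f ∂(fun _ => P) :=
    (lmarginal_singleton (μ := fun _ => P) f t).symm
  rw [hg]
  -- Both integrands have the same marginal over coordinate `t`: the inner integral no longer
  -- depends on that coordinate.
  refine lintegral_eq_of_lmarginal_eq {t} hf (hf.lmarginal _) ?_
  rw [lmarginal_singleton (∫⋯∫⁻_{t}, f ∂(fun _ => P))]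
  funext x
  simp [lmarginal_update_of_mem]

theorem measurable_ofReal_inner_sub_sq {d : ℕ} {α : Type*} [MeasurableSpace α] (u w : E d)
    {g : α → E d} (hg : Measurable g) :
    Measurable fun a => ENNReal.ofReal (inner ℝ u (g a - w) ^ 2) :=
  ENNReal.measurable_ofReal.comp
    ((show Continuous fun x : E d => inner ℝ u (x - w) ^ 2 by fun_prop).measurable.comp hg)

/-! ### Measurability of the iterates -/

namespace Algorithm

variable {d T : ℕ}

theorem measurable_history (A : Algorithm d T) (t : ℕ) (h : t ≤ T) :
    Measurable fun p : (Fin T → E d) × (Fin T → Obs d) => A.history p.1 p.2 t h := by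
  induction t with
  | zero => exact measurable_const
  | succ t ih =>
    have ih' := ih (Nat.le_of_succ_le h)
    refine measurable_pi_lambda _ fun i => ?_
    refine Fin.lastCases ?_ (fun j => ?_) i
    · simp only [history, Fin.snoc_last]
      refine (A.measurable_step ⟨t, h⟩).comp (Measurable.prodMk ?_ (Measurable.prodMk ?_ ih'))
      · exact (measurable_pi_apply _).comp measurable_fst
      · exact measurable_pi_lambda _ fun k => (measurable_pi_apply _).comp measurable_snd
    · simp only [history, Fin.snoc_castSucc]
      exact (measurable_pi_apply j).comp ih'

theorem measurable_iterate (A : Algorithm d T) (t : ℕ) (h : t ≤ T) :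
    Measurable fun p : (Fin T → E d) × (Fin T → Obs d) => A.iterate p.1 p.2 t h :=
  (measurable_pi_apply _).comp (A.measurable_history t h)

end Algorithm

/-! ### Second moments and risk of SGD -/

section SGD

variable {d T : ℕ} {H : Matrix (Fin d) (Fin d) ℝ} {v : OrthonormalBasis (Fin d) ℝ (E d)}
  {lam : Fin d → ℝ} {μ : Measure (Obs d)} {σ η₀ c : ℝ}

/-- The iterate `t` of SGD does not depend on the observations from number `t` on. -/
theorem sgd_iterate_update (s : Fin T → E d) (x : Fin T → Obs d) (r : Fin T) (z : Obs d)
    (t : ℕ) (h : t ≤ T) (hr : t ≤ r) :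
    (sgd d T η₀).iterate s (Function.update x r z) t h = (sgd d T η₀).iterate s x t h := by
  induction t with
  | zero => rfl
  | succ t ih =>
    have hne : (⟨t, h⟩ : Fin T) ≠ r := fun he => by
      have := congrArg Fin.val he
      simp only at this
      omega
    rw [sgd_iterate_succ η₀ s _ t h, sgd_iterate_succ η₀ s _ t h, ih _ (by omega),
      Function.update_of_ne hne]

theorem measurable_sgd_iterate (t : ℕ) (h : t ≤ T) :
    Measurable fun x : Fin T → Obs d => (sgd d T η₀).iterate 0 x t h :=
  ((sgd d T η₀).measurable_iterate t h).comp measurable_prodMk_left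

theorem sgd_jointLaw [IsProbabilityMeasure μ] :
    (sgd d T η₀).jointLaw μ = (Measure.pi fun _ : Fin T => μ).map (Prod.mk 0) := by
  rw [Algorithm.jointLaw]
  exact Measure.dirac_prod 0

/-- The second moment of SGD in an eigendirection satisfies the scalar recursion. -/
theorem sgd_moment_le [IsProbabilityMeasure μ] (h : IsEigenDecomposition H v lam)
    (hi : ∀ i j, Integrable (fun z : Obs d => z.1 i j) μ)
    (hb : Integrable (fun z : Obs d => z.2) μ)
    (hH : ∀ i j, ∫ z, z.1 i j ∂μ = H i j) {wStar : E d} (hs : mulE H wStar = ∫ z, z.2 ∂μ)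
    (hn : (sgd d T η₀).GradientNoise H σ μ) (i : Fin d) (hc : |inner ℝ (v i) wStar| ≤ c)
    (t : ℕ) (ht : t ≤ T) :
    ∫⁻ x, ENNReal.ofReal (inner ℝ (v i) ((sgd d T η₀).iterate 0 x t ht - wStar) ^ 2)
        ∂(Measure.pi fun _ : Fin T => μ) ≤
      ENNReal.ofReal (momentBound η₀ (lam i) σ c T t) := by
  induction t with
  | zero =>
    have h0 : ∀ x : Fin T → Obs d, (sgd d T η₀).iterate 0 x 0 ht = 0 := fun _ => rfl
    simp only [h0, lintegral_const, measure_univ, mul_one, momentBound_zero, zero_sub,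
      inner_neg_right, neg_sq]
    -- Since `w₀ = 0`, the initial error is `-wStar`, with coordinate at most `c`.
    exact ENNReal.ofReal_le_ofReal (sq_le_sq' (by linarith [(abs_le.1 hc).1]) (abs_le.1 hc).2)
  | succ t ih =>
    have hm := measurable_ofReal_inner_sub_sq (v i) wStar
      (measurable_sgd_iterate (d := d) (η₀ := η₀) (t + 1) ht)
    have hm0 := measurable_ofReal_inner_sub_sq (v i) wStar
      (measurable_sgd_iterate (d := d) (η₀ := η₀) t (Nat.le_of_succ_le ht))
    have hnoise : ∀ᵐ x ∂(Measure.pi fun _ : Fin T => μ),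
        NoiseBoundAt H σ μ ((sgd d T η₀).iterate 0 x t (Nat.le_of_succ_le ht)) := by
      have := hn t ht
      rw [sgd_jointLaw] at this
      exact ae_of_ae_map measurable_prodMk_left.aemeasurable this
    -- Resampling observation `t` plays the role of conditioning: iterate `t` does not see it, so
    -- the inner integral is a one-step expectation from a fixed point.
    calc _ = ∫⁻ x, ∫⁻ z, ENNReal.ofReal (inner ℝ (v i)
            ((sgd d T η₀).iterate 0 (Function.update x ⟨t, ht⟩ z) (t + 1) ht - wStar) ^ 2) ∂μ
          ∂(Measure.pi fun _ : Fin T => μ) := lintegral_pi_update μ hm ⟨t, ht⟩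
      _ ≤ ∫⁻ x, (ENNReal.ofReal (contraction η₀ (lam i) T t) * ENNReal.ofReal (inner ℝ (v i)
            ((sgd d T η₀).iterate 0 x t (Nat.le_of_succ_le ht) - wStar) ^ 2) +
            ENNReal.ofReal (stepSize η₀ T t ^ 2 * (σ ^ 2 * lam i)))
          ∂(Measure.pi fun _ : Fin T => μ) := by
        refine lintegral_mono_ae (hnoise.mono fun x hx => ?_)
        refine le_trans (lintegral_mono fun z => le_of_eq ?_)
          (lintegral_sgdStep_le h hi hb hH hs hx (stepSize η₀ T t) i)
        rw [sgd_iterate_succ η₀ 0 _ t ht, sgd_iterate_update 0 x ⟨t, ht⟩ z t _ le_rfl,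
          Function.update_self]
      _ ≤ ENNReal.ofReal (contraction η₀ (lam i) T t) *
            ENNReal.ofReal (momentBound η₀ (lam i) σ c T t) +
            ENNReal.ofReal (stepSize η₀ T t ^ 2 * (σ ^ 2 * lam i)) := by
        rw [lintegral_add_right _ measurable_const, lintegral_const_mul _ hm0, lintegral_const,
          measure_univ, mul_one]
        gcongr
        exact ih _
      _ = ENNReal.ofReal (momentBound η₀ (lam i) σ c T (t + 1)) := by
        have hl := h.lam_nonneg i
        have hmb := momentBound_nonneg (η₀ := η₀) (T := T) hl σ c t
        have hct := contraction_nonneg (η₀ := η₀) (lam := lam i) (T := T) t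
        rw [momentBound_succ, ENNReal.ofReal_add (mul_nonneg hct hmb) (by positivity),
          ENNReal.ofReal_mul hct]

theorem sgd_excessRisk_le (h : IsEigenDecomposition H v lam)
    (hμ : InOptimumClass H v (fun _ => c) μ) (hn : (sgd d T η₀).GradientNoise H σ μ) :
    (sgd d T η₀).excessRisk μ ≤
      ENNReal.ofReal (1 / 2 * ∑ i, lam i * momentBound η₀ (lam i) σ c T T) := by
  have := hμ.isProbability
  obtain ⟨wStar, hmin, hc⟩ := hμ.optimum
  have hi := hμ.integrable_hess
  have hb := hμ.integrable_lin
  have hH := hμ.mean_hess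
  have hs := stationary_of_objective_le h hi hb hH hmin
  have hm := fun i => measurable_ofReal_inner_sub_sq (v i) wStar
    (measurable_sgd_iterate (d := d) (η₀ := η₀) T le_rfl)
  have hterm : ∀ i, 0 ≤ lam i * momentBound η₀ (lam i) σ c T T := fun i =>
    mul_nonneg (h.lam_nonneg i) (momentBound_nonneg (h.lam_nonneg i) σ c T)
  have hrisk : ∀ w, ENNReal.ofReal (objective μ w - ⨅ w', objective μ w') =
      ∑ i, ENNReal.ofReal (1 / 2 * lam i) *
        ENNReal.ofReal (inner ℝ (v i) (w - wStar) ^ 2) := fun w => by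
    have hl := h.lam_nonneg
    rw [objective_sub_iInf h hi hb hH hs, Finset.mul_sum, ENNReal.ofReal_sum_of_nonneg
      fun i _ => by have := hl i; positivity]
    refine Finset.sum_congr rfl fun i _ => ?_
    rw [← mul_assoc, ENNReal.ofReal_mul (by have := hl i; positivity)]
  rw [Algorithm.excessRisk, sgd_jointLaw]
  simp only [hrisk, Algorithm.output]
  rw [lintegral_map (Finset.measurable_sum _ fun i _ =>
      (measurable_ofReal_inner_sub_sq (v i) wStar
        ((sgd d T η₀).measurable_iterate T le_rfl)).const_mul _) measurable_prodMk_left]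
  change ∫⁻ x, ∑ i, ENNReal.ofReal (1 / 2 * lam i) *
    ENNReal.ofReal (inner ℝ (v i) ((sgd d T η₀).iterate 0 x T le_rfl - wStar) ^ 2)
      ∂(Measure.pi fun _ : Fin T => μ) ≤ _
  rw [lintegral_finsetSum _ fun i _ => (hm i).const_mul _, Finset.mul_sum,
    ENNReal.ofReal_sum_of_nonneg fun i _ => mul_nonneg (by norm_num) (hterm i)]
  refine Finset.sum_le_sum fun i _ => ?_
  rw [lintegral_const_mul _ (hm i), ← mul_assoc,
    ENNReal.ofReal_mul (p := 1 / 2 * lam i) (by have := h.lam_nonneg i; positivity)]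
  gcongr
  exact sgd_moment_le h hi hb hH hs hn i (hc i) T le_rfl

end SGD

/-! ### The SGD rate and the minimax rate -/

theorem natLog_le_logb {T : ℕ} (hT : 16 ≤ T) : (Nat.log 2 T : ℝ) ≤ Real.logb 2 T := by
  rw [Real.le_logb_iff_rpow_le (by norm_num) (by positivity), Real.rpow_natCast]
  exact_mod_cast Nat.pow_log_le_self 2 (by omega)

theorem one_le_natLog {T : ℕ} (hT : 16 ≤ T) : (1 : ℝ) ≤ Nat.log 2 T := by
  exact_mod_cast Nat.log_pos (by norm_num) (by omega)

theorem one_le_logb {T : ℕ} (hT : 16 ≤ T) : 1 ≤ Real.logb 2 T :=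
  (one_le_natLog hT).trans (natLog_le_logb hT)

/-- The right-hand side of the upper bound for SGD. -/
noncomputable def sgdRate {d : ℕ} (lam : Fin d → ℝ) (T : ℕ) (c : ℝ) : ℝ :=
  effDim lam (1 / T) * Real.logb 2 T ^ 4 / T +
    Real.logb 2 T ^ 2 * (tailSum lam (effDim lam (1 / T)) * c ^ 2)

theorem sgdRate_eq_sum {d : ℕ} {lam : Fin d → ℝ} (h : Antitone lam) (T : ℕ) (c : ℝ) :
    sgdRate lam T c = ∑ i, if (1 / T : ℝ) ≤ lam i then Real.logb 2 T ^ 4 / T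
      else lam i * (Real.logb 2 T ^ 2 * c ^ 2) := by
  rw [← effDim_mul_add_tailSum_mul h, sgdRate]
  ring

/-- The comparison is termwise. The summands of the constant pay for, in order, head bias, head
noise, tail bias and tail noise. The head estimate only loses `n ^ 2`, which is relaxed to `L ^ 4`.
-/
theorem sum_lam_mul_momentBound_le {d T : ℕ} {lam : Fin d → ℝ} {c η₀ : ℝ} (hc : 0 < c)
    (hη : 0 < η₀) (hT : 16 ≤ T) (hanti : Antitone lam) (hl : ∀ i, 0 ≤ lam i)
    (h1 : ∀ i, η₀ * lam i ≤ 1) (σ : ℝ) :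
    1 / 2 * ∑ i, lam i * momentBound η₀ (lam i) σ c T T ≤
      (c ^ 2 / η₀ + 32 + 1 + η₀ ^ 2 / c ^ 2) * ((1 + σ ^ 2) * sgdRate lam T c) := by
  have hT0 : (0 : ℝ) < T := by positivity
  have hL := natLog_le_logb hT
  have hn := one_le_natLog hT
  have hL1 := one_le_logb hT
  set L := Real.logb 2 T with hLdef
  set n : ℝ := (Nat.log 2 T : ℝ) with hndef
  have hL2 : 1 ≤ L ^ 2 := one_le_pow₀ hL1
  have hL4 : n ^ 2 ≤ L ^ 4 := by
    calc n ^ 2 ≤ L ^ 2 := by gcongr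
      _ ≤ L ^ 4 := pow_le_pow_right₀ hL1 (by norm_num)
  have hnL : n ≤ L ^ 4 := le_trans (by nlinarith) hL4
  rw [sgdRate_eq_sum hanti, ← mul_assoc, Finset.mul_sum, Finset.mul_sum]
  refine Finset.sum_le_sum fun i _ => ?_
  have hm : 0 ≤ lam i * momentBound η₀ (lam i) σ c T T :=
    mul_nonneg (hl i) (momentBound_nonneg (hl i) σ c T)
  refine le_trans (show _ ≤ lam i * momentBound η₀ (lam i) σ c T T by linarith) ?_
  split_ifs with hi
  · calc lam i * momentBound η₀ (lam i) σ c T T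
        ≤ c ^ 2 * (n / (η₀ * T)) + σ ^ 2 * (32 * n ^ 2 / T) :=
          lam_mul_momentBound_le_head hη (hl i) (h1 i) hT σ c
      _ ≤ c ^ 2 * (L ^ 4 / (η₀ * T)) + σ ^ 2 * (32 * L ^ 4 / T) := by gcongr
      _ = (c ^ 2 / η₀ + σ ^ 2 * 32) * (L ^ 4 / T) := by field_simp
      _ ≤ ((c ^ 2 / η₀ + 32 + 1 + η₀ ^ 2 / c ^ 2) * (1 + σ ^ 2)) * (L ^ 4 / T) := by
          have h2 : 0 ≤ c ^ 2 / η₀ := by positivity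
          have h3 : 0 ≤ η₀ ^ 2 / c ^ 2 := by positivity
          have h4 : 0 ≤ σ ^ 2 := sq_nonneg σ
          gcongr
          nlinarith [mul_nonneg h2 h4, mul_nonneg h3 h4]
  · have hlT : lam i * T ≤ 1 := by
      rw [not_le, lt_div_iff₀ hT0] at hi
      exact hi.le
    calc lam i * momentBound η₀ (lam i) σ c T T
        ≤ lam i * c ^ 2 + σ ^ 2 * (lam i * η₀ ^ 2) :=
          lam_mul_momentBound_le_tail hη (hl i) (h1 i) hlT σ c
      _ = (1 + σ ^ 2 * (η₀ ^ 2 / c ^ 2)) * (lam i * (1 * c ^ 2)) := by field_simp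
      _ ≤ ((c ^ 2 / η₀ + 32 + 1 + η₀ ^ 2 / c ^ 2) * (1 + σ ^ 2)) *
            (lam i * (L ^ 2 * c ^ 2)) := by
          have hli := hl i
          have h2 : 0 ≤ c ^ 2 / η₀ := by positivity
          have h3 : 0 ≤ η₀ ^ 2 / c ^ 2 := by positivity
          have h4 : 0 ≤ σ ^ 2 := sq_nonneg σ
          gcongr
          nlinarith [mul_nonneg h2 h4, mul_nonneg h3 h4]

/-- The upper bound for SGD with an explicit constant. -/
theorem sgd_excessRisk_le_rate {d T : ℕ} {H : Matrix (Fin d) (Fin d) ℝ}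
    {v : OrthonormalBasis (Fin d) ℝ (E d)} {lam : Fin d → ℝ} {μ : Measure (Obs d)}
    {σ η₀ c : ℝ} (hc : 0 < c) (hη : 0 < η₀) (hT : 16 ≤ T) (h : IsEigenDecomposition H v lam)
    (h1 : ∀ i, η₀ * lam i ≤ 1) (hμ : InOptimumClass H v (fun _ => c) μ)
    (hn : (sgd d T η₀).GradientNoise H σ μ) :
    (sgd d T η₀).excessRisk μ ≤ ENNReal.ofReal
      ((c ^ 2 / η₀ + 32 + 1 + η₀ ^ 2 / c ^ 2) * ((1 + σ ^ 2) * sgdRate lam T c)) :=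
  (sgd_excessRisk_le h hμ hn).trans <| ENNReal.ofReal_le_ofReal <|
    sum_lam_mul_momentBound_le hc hη hT h.antitone h.lam_nonneg h1 σ

/-- The right-hand side of the lower bound, up to the numerical constant. -/
noncomputable def minimaxRate {d : ℕ} (lam : Fin d → ℝ) (T : ℕ) (c σ : ℝ) : ℝ :=
  effDim lam (σ ^ 2 / (T * c ^ 2)) * σ ^ 2 / T +
    tailSum lam (effDim lam (σ ^ 2 / (T * c ^ 2))) * c ^ 2

theorem minimaxRate_eq_sum {d : ℕ} {lam : Fin d → ℝ} (h : Antitone lam) (T : ℕ) (c σ : ℝ) :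
    minimaxRate lam T c σ =
      ∑ i, if σ ^ 2 / (T * c ^ 2) ≤ lam i then σ ^ 2 / T else lam i * c ^ 2 := by
  rw [← effDim_mul_add_tailSum_mul h, minimaxRate]
  ring

/-- The two rates agree up to a constant and the logarithmic factor. -/
theorem sgdRate_le_minimaxRate {d T : ℕ} {lam : Fin d → ℝ} {c σ : ℝ} (hc : 0 < c) (hσ : 0 < σ)
    (hT : 16 ≤ T) (hanti : Antitone lam) (hl : ∀ i, 0 ≤ lam i) :
    sgdRate lam T c ≤ (1 + 1 / σ ^ 2 + 1 / c ^ 2 + c ^ 2 / σ ^ 2) * Real.logb 2 T ^ 4 *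
      minimaxRate lam T c σ := by
  have hT0 : (0 : ℝ) < T := by positivity
  have hL1 := one_le_logb hT
  set L := Real.logb 2 T with hLdef
  have hL24 : L ^ 2 ≤ L ^ 4 := pow_le_pow_right₀ hL1 (by norm_num)
  have hA : 0 < 1 / σ ^ 2 := by positivity
  have hB : 0 < 1 / c ^ 2 := by positivity
  have hD : 0 < c ^ 2 / σ ^ 2 := by positivity
  rw [sgdRate_eq_sum hanti, minimaxRate_eq_sum hanti, Finset.mul_sum]
  refine Finset.sum_le_sum fun i _ => ?_
  have hli := hl i
  -- The four cases produce the constants `1 / σ ^ 2`, `1 / c ^ 2`, `c ^ 2 / σ ^ 2` and `1`. The two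
  -- mixed ones only use how `lam i` compares with `1 / T`.
  split_ifs with hi hj hj
  · calc L ^ 4 / T = (1 / σ ^ 2) * L ^ 4 * (σ ^ 2 / T) := by field_simp
      _ ≤ _ := by gcongr; linarith
  · rw [div_le_iff₀ hT0] at hi
    calc L ^ 4 / T = L ^ 4 / T * 1 := by ring
      _ ≤ L ^ 4 / T * (lam i * T) := by gcongr
      _ = (1 / c ^ 2) * L ^ 4 * (lam i * c ^ 2) := by field_simp
      _ ≤ _ := by gcongr; linarith
  · rw [not_le, lt_div_iff₀ hT0] at hi
    calc lam i * (L ^ 2 * c ^ 2) = lam i * T * (L ^ 2 * c ^ 2 / T) := by field_simp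
      _ ≤ 1 * (L ^ 4 * c ^ 2 / T) := by gcongr
      _ = (c ^ 2 / σ ^ 2) * L ^ 4 * (σ ^ 2 / T) := by field_simp
      _ ≤ _ := by gcongr; linarith
  · calc lam i * (L ^ 2 * c ^ 2) = 1 * L ^ 2 * (lam i * c ^ 2) := by ring
      _ ≤ _ := by gcongr; linarith

/-! ### Hellinger affinity and Assouad's method for biased coins -/

section Assouad

/-- Hellinger form of Le Cam's two-point bound for the squared loss. -/
theorem two_point_bound {X : Type*} [Fintype X] {p q : X → ℝ} (hp : ∀ x, 0 ≤ p x)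
    (hq : ∀ x, 0 ≤ q x) (hp1 : ∑ x, p x = 1) (hq1 : ∑ x, q x = 1) (a : X → ℝ) (δ : ℝ) :
    2 * δ ^ 2 * (∑ x, √(p x * q x)) ^ 2 ≤
      ∑ x, p x * (a x - δ) ^ 2 + ∑ x, q x * (a x + δ) ^ 2 := by
  -- Cauchy–Schwarz for `√p` and `√q * b`, using `∑ p = 1`.
  have hcs : ∀ {p q : X → ℝ}, (∀ x, 0 ≤ p x) → (∀ x, 0 ≤ q x) → ∑ x, p x = 1 → ∀ b : X → ℝ,
      (∑ x, √(p x * q x) * b x) ^ 2 ≤ ∑ x, q x * b x ^ 2 := fun {p q} hp hq hp1 b => by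
    have h := Finset.sum_mul_sq_le_sq_mul_sq Finset.univ (fun x => √(p x)) fun x => √(q x) * b x
    simp only [mul_pow, Real.sq_sqrt (hp _), Real.sq_sqrt (hq _), hp1, one_mul] at h
    simpa only [Real.sqrt_mul (hp _), mul_assoc] using h
  have h1 := hcs hp hq hp1 fun x => a x + δ
  have h2 := hcs hq hp hq1 fun x => a x - δ
  -- Write `2δ = (a + δ) - (a - δ)`, then use `(u - v)² ≤ 2u² + 2v²`.
  have h3 : 2 * δ * ∑ x, √(p x * q x) =
      ∑ x, √(p x * q x) * (a x + δ) - ∑ x, √(q x * p x) * (a x - δ) := by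
    rw [← Finset.sum_sub_distrib, Finset.mul_sum]
    refine Finset.sum_congr rfl fun x _ => ?_
    rw [mul_comm (q x)]; ring
  have h4 := congrArg (· ^ 2) h3
  nlinarith [sq_nonneg (∑ x, √(p x * q x) * (a x + δ) + ∑ x, √(q x * p x) * (a x - δ))]

/-- The sign of a Boolean. -/
def sgn (b : Bool) : ℝ := if b then 1 else -1

theorem sgn_sq (b : Bool) : sgn b ^ 2 = 1 := by cases b <;> simp [sgn]

theorem sgn_not (b : Bool) : sgn (!b) = -sgn b := by cases b <;> simp [sgn]

theorem abs_sgn (b : Bool) : |sgn b| = 1 := by cases b <;> simp [sgn]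

/-- The probabilities of a coin with bias `ρ`. -/
noncomputable def coinWeight (ρ : ℝ) (b : Bool) : ℝ := (1 + ρ * sgn b) / 2

theorem coinWeight_nonneg {ρ : ℝ} (h : |ρ| ≤ 1) (b : Bool) : 0 ≤ coinWeight ρ b := by
  have := abs_le.1 h
  cases b <;> simp only [coinWeight, sgn] <;> norm_num <;> linarith

theorem sum_coinWeight (ρ : ℝ) : ∑ b, coinWeight ρ b = 1 := by
  simp [coinWeight, sgn]; ring

variable {d T : ℕ}

/-- The probabilities of `T` draws of `d` independent coins. -/
noncomputable def drawWeight (ρ : Fin d → ℝ) (x : Fin T → Fin d → Bool) : ℝ :=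
  ∏ t, ∏ i, coinWeight (ρ i) (x t i)

theorem drawWeight_nonneg {ρ : Fin d → ℝ} (h : ∀ i, |ρ i| ≤ 1) (x : Fin T → Fin d → Bool) :
    0 ≤ drawWeight ρ x :=
  Finset.prod_nonneg fun _ _ => Finset.prod_nonneg fun i _ => coinWeight_nonneg (h i) _

/-- Distributivity over coordinates and draws. Total mass and affinity both tensorize through this
identity. -/
theorem sum_prod_prod_eq_pow (f : Fin d → Bool → ℝ) :
    ∑ x : Fin T → Fin d → Bool, ∏ t, ∏ i, f i (x t i) = (∏ i, ∑ b, f i b) ^ T := by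
  rw [Finset.prod_univ_sum, Fintype.piFinset_univ, Finset.sum_pow', Fintype.piFinset_univ]

theorem sum_drawWeight (ρ : Fin d → ℝ) :
    ∑ x : Fin T → Fin d → Bool, drawWeight ρ x = 1 := by
  simp only [drawWeight]
  rw [sum_prod_prod_eq_pow fun i b => coinWeight (ρ i) b]
  simp only [sum_coinWeight, Finset.prod_const_one, one_pow]

/-- The Hellinger affinity of two biased coins with opposite biases. -/
theorem sum_sqrt_coinWeight_neg (ρ : ℝ) :
    ∑ b, √(coinWeight ρ b * coinWeight (-ρ) b) = √(1 - ρ ^ 2) := by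
  have h : ∀ b, coinWeight ρ b * coinWeight (-ρ) b = (1 - ρ ^ 2) / 2 ^ 2 := fun b => by
    simp only [coinWeight]
    have := sgn_sq b
    linear_combination (-ρ ^ 2 / 4) * this
  simp only [h, Real.sqrt_div' _ (sq_nonneg (2 : ℝ)), Real.sqrt_sq zero_le_two]
  rw [Fintype.sum_bool]
  ring

theorem sum_sqrt_coinWeight_self {ρ : ℝ} (h : |ρ| ≤ 1) :
    ∑ b, √(coinWeight ρ b * coinWeight ρ b) = 1 := by
  simp only [Real.sqrt_mul_self (coinWeight_nonneg h _)]
  exact sum_coinWeight ρ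

/-- The Hellinger affinity of two product laws that differ in one coordinate. -/
theorem affinity_drawWeight {ρ ρ' : Fin d → ℝ} (h : ∀ i, |ρ i| ≤ 1) (h' : ∀ i, |ρ' i| ≤ 1)
    (i : Fin d) (hi : ρ' i = -ρ i) (hne : ∀ j, j ≠ i → ρ' j = ρ j) :
    (∑ x : Fin T → Fin d → Bool, √(drawWeight ρ x * drawWeight ρ' x)) ^ 2 =
      (1 - ρ i ^ 2) ^ T := by
  have hs : ∀ x : Fin T → Fin d → Bool, √(drawWeight ρ x * drawWeight ρ' x) =
      ∏ t, ∏ j, √(coinWeight (ρ j) (x t j) * coinWeight (ρ' j) (x t j)) := fun x => by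
    have hnn := fun t j => mul_nonneg (coinWeight_nonneg (h j) (x t j))
      (coinWeight_nonneg (h' j) (x t j))
    rw [drawWeight, drawWeight, ← Finset.prod_mul_distrib, Real.sqrt_prod _ fun t _ => by
      rw [← Finset.prod_mul_distrib]; exact Finset.prod_nonneg fun j _ => hnn t j]
    refine Finset.prod_congr rfl fun t _ => ?_
    rw [← Finset.prod_mul_distrib, Real.sqrt_prod _ fun j _ => hnn t j]
  simp only [hs]
  rw [sum_prod_prod_eq_pow fun j b => √(coinWeight (ρ j) b * coinWeight (ρ' j) b),
    Finset.prod_eq_single i (fun j _ hj => by rw [hne j hj]; exact sum_sqrt_coinWeight_self (h j))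
      (fun hn => absurd (Finset.mem_univ i) hn),
    hi, sum_sqrt_coinWeight_neg, ← pow_mul, mul_comm, pow_mul, Real.sq_sqrt]
  have := sq_le_one_iff_abs_le_one (ρ i) |>.2 (h i)
  linarith

/-- Assouad's bound in one coordinate. -/
theorem assouad_coordinate {ρ : Fin d → ℝ} (h : ∀ i, |ρ i| ≤ 1) (i : Fin d)
    (a : (Fin T → Fin d → Bool) → ℝ) (δ : ℝ) :
    2 ^ d * (δ ^ 2 * (1 - ρ i ^ 2) ^ T) ≤
      ∑ τ : Fin d → Bool, ∑ x, drawWeight (fun j => ρ j * sgn (τ j)) x *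
        (a x - sgn (τ i) * δ) ^ 2 := by
  set g : (Fin d → Bool) → ℝ := fun τ => ∑ x, drawWeight (fun j => ρ j * sgn (τ j)) x *
    (a x - sgn (τ i) * δ) ^ 2 with hg
  have habs : ∀ (τ : Fin d → Bool) j, |ρ j * sgn (τ j)| ≤ 1 := fun τ j => by
    rw [abs_mul, abs_sgn, mul_one]; exact h j
  -- Flipping sign `i` is an involution, so summing the pair bound counts each sign vector twice,
  -- which cancels the 2 of the two-point bound.
  let flip : (Fin d → Bool) → (Fin d → Bool) := fun τ => Function.update τ i (!τ i)
  have hflip : Function.Involutive flip := fun τ => by simp [flip]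
  have hsum : ∑ τ, g (flip τ) = ∑ τ, g τ := hflip.bijective.sum_comp g
  have hpair : ∀ τ, 2 * (δ ^ 2 * (1 - ρ i ^ 2) ^ T) ≤ g τ + g (flip τ) := fun τ => by
    have hb := two_point_bound (drawWeight_nonneg (T := T) (habs τ))
      (drawWeight_nonneg (habs (flip τ))) (sum_drawWeight _) (sum_drawWeight _) a (sgn (τ i) * δ)
    rw [affinity_drawWeight (habs τ) (habs (flip τ)) i (by simp [flip, sgn_not])
      (fun j hj => by simp [flip, hj]), mul_pow, mul_pow, sgn_sq, one_mul, mul_one] at hb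
    have hf : sgn (flip τ i) = -sgn (τ i) := by simp [flip, sgn_not]
    simp only [hg, hf, neg_mul, sub_neg_eq_add]
    linarith
  have htot := Finset.sum_le_sum fun τ (_ : τ ∈ Finset.univ) => hpair τ
  rw [Finset.sum_add_distrib, hsum, Finset.sum_const, Finset.card_univ, Fintype.card_fun,
    Fintype.card_bool, Fintype.card_fin, nsmul_eq_mul] at htot
  push_cast at htot
  linarith

/-- Each coordinate bound is already summed over all sign vectors with the same rule `a`, so the
bounds add up with weights `lam i / 2`. -/
theorem assouad {ρ : Fin d → ℝ} (h : ∀ i, |ρ i| ≤ 1) {lam : Fin d → ℝ} (hl : ∀ i, 0 ≤ lam i)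
    (a : (Fin T → Fin d → Bool) → Fin d → ℝ) (δ : Fin d → ℝ) :
    2 ^ d * ∑ i, 1 / 2 * (lam i * (δ i ^ 2 * (1 - ρ i ^ 2) ^ T)) ≤
      ∑ τ : Fin d → Bool, ∑ x, drawWeight (fun j => ρ j * sgn (τ j)) x *
        (1 / 2 * ∑ i, lam i * (a x i - sgn (τ i) * δ i) ^ 2) := by
  calc _ = ∑ i, 1 / 2 * lam i * (2 ^ d * (δ i ^ 2 * (1 - ρ i ^ 2) ^ T)) := by
        rw [Finset.mul_sum]; exact Finset.sum_congr rfl fun i _ => by ring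
    _ ≤ ∑ i, 1 / 2 * lam i * ∑ τ : Fin d → Bool, ∑ x,
          drawWeight (fun j => ρ j * sgn (τ j)) x * (a x i - sgn (τ i) * δ i) ^ 2 := by
        refine Finset.sum_le_sum fun i _ => mul_le_mul_of_nonneg_left
          (assouad_coordinate h i (fun x => a x i) (δ i)) ?_
        have := hl i
        positivity
    _ = _ := by
        simp only [Finset.mul_sum]
        rw [Finset.sum_comm]
        refine Finset.sum_congr rfl fun τ _ => ?_
        rw [Finset.sum_comm]
        exact Finset.sum_congr rfl fun x _ => Finset.sum_congr rfl fun i _ => by ring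

end Assouad

/-! ### The hard problems: deterministic Hessian, random signs in the linear part -/

section HardProblem

/-- The law of a coin with bias `ρ`. -/
noncomputable def coin (ρ : ℝ) : Measure Bool :=
  ENNReal.ofReal (coinWeight ρ true) • Measure.dirac true +
    ENNReal.ofReal (coinWeight ρ false) • Measure.dirac false

theorem coin_singleton (ρ : ℝ) (b : Bool) : coin ρ {b} = ENNReal.ofReal (coinWeight ρ b) := by
  cases b <;> simp [coin]

theorem isProbabilityMeasure_coin {ρ : ℝ} (h : |ρ| ≤ 1) : IsProbabilityMeasure (coin ρ) := by
  constructor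
  have hs := sum_coinWeight ρ
  rw [Fintype.sum_bool] at hs
  simp only [coin, Measure.coe_add, Measure.coe_smul, Pi.add_apply, Pi.smul_apply, measure_univ,
    smul_eq_mul, mul_one]
  rw [← ENNReal.ofReal_add (coinWeight_nonneg h _) (coinWeight_nonneg h _), hs, ENNReal.ofReal_one]

theorem integral_coin {ρ : ℝ} (h : |ρ| ≤ 1) (f : Bool → ℝ) :
    ∫ b, f b ∂coin ρ = ∑ b, coinWeight ρ b * f b := by
  have := isProbabilityMeasure_coin h
  rw [integral_fintype Integrable.of_finite]
  refine Finset.sum_congr rfl fun b _ => ?_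
  rw [Measure.real, coin_singleton, ENNReal.toReal_ofReal (coinWeight_nonneg h b), smul_eq_mul]

theorem integral_sgn_coin {ρ : ℝ} (h : |ρ| ≤ 1) : ∫ b, sgn b ∂coin ρ = ρ := by
  rw [integral_coin h, Fintype.sum_bool]
  simp [coinWeight, sgn]; ring

theorem variance_mul_sgn_coin_le {ρ : ℝ} (h : |ρ| ≤ 1) (a : ℝ) :
    ProbabilityTheory.variance (fun b => a * sgn b) (coin ρ) ≤ a ^ 2 := by
  have := isProbabilityMeasure_coin h
  refine (ProbabilityTheory.variance_le_expectation_sq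
    (measurable_of_finite _).aestronglyMeasurable).trans (le_of_eq ?_)
  simp only [Pi.pow_apply, mul_pow, sgn_sq, mul_one, integral_const, probReal_univ, smul_eq_mul,
    one_mul]

variable {d : ℕ}

/-- The observation with Hessian `H` whose linear part has coordinates `± r i` in the basis `v`. -/
noncomputable def signedObs (H : Matrix (Fin d) (Fin d) ℝ) (v : OrthonormalBasis (Fin d) ℝ (E d))
    (r : Fin d → ℝ) (y : Fin d → Bool) : Obs d :=
  (H, ∑ i, (r i * sgn (y i)) • v i)

/-- The problem with deterministic Hessian `H` and independent two-valued coordinates of the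
linear part. -/
noncomputable def signedProblem (H : Matrix (Fin d) (Fin d) ℝ)
    (v : OrthonormalBasis (Fin d) ℝ (E d)) (r ρ : Fin d → ℝ) : Measure (Obs d) :=
  (Measure.pi fun i => coin (ρ i)).map (signedObs H v r)

variable {H : Matrix (Fin d) (Fin d) ℝ} {v : OrthonormalBasis (Fin d) ℝ (E d)}
  {lam r ρ : Fin d → ℝ}

theorem measurable_signedObs : Measurable (signedObs H v r) := measurable_of_finite _

theorem isProbabilityMeasure_signedProblem (h : ∀ i, |ρ i| ≤ 1) :
    IsProbabilityMeasure (signedProblem H v r ρ) := by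
  have := fun i => isProbabilityMeasure_coin (h i)
  exact Measure.isProbabilityMeasure_map measurable_signedObs.aemeasurable

theorem integrable_signedProblem (h : ∀ i, |ρ i| ≤ 1) {F : Type*} [NormedAddCommGroup F]
    [MeasurableSpace F] [BorelSpace F] [SecondCountableTopology F] {g : Obs d → F}
    (hg : Measurable g) : Integrable g (signedProblem H v r ρ) := by
  have := fun i => isProbabilityMeasure_coin (h i)
  rw [signedProblem, integrable_map_measure hg.aestronglyMeasurable
    measurable_signedObs.aemeasurable]
  exact Integrable.of_finite

theorem measurable_hess_apply (i j : Fin d) : Measurable fun z : Obs d => z.1 i j :=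
  (measurable_pi_apply j).comp ((measurable_pi_apply i).comp measurable_fst)

theorem integral_hess_signedProblem (h : ∀ i, |ρ i| ≤ 1) (i j : Fin d) :
    ∫ z, z.1 i j ∂signedProblem H v r ρ = H i j := by
  have := fun i => isProbabilityMeasure_coin (h i)
  rw [signedProblem, integral_map measurable_signedObs.aemeasurable
    (measurable_hess_apply i j).aestronglyMeasurable]
  simp [signedObs]

theorem integral_sgn_pi (h : ∀ i, |ρ i| ≤ 1) (i : Fin d) :
    ∫ y, sgn (y i) ∂(Measure.pi fun j => coin (ρ j)) = ρ i := by
  have := fun i => isProbabilityMeasure_coin (h i)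
  rw [← integral_sgn_coin (h i), ← (measurePreserving_eval (fun j => coin (ρ j)) i).map_eq,
    integral_map (measurable_pi_apply i).aemeasurable
      (measurable_of_finite _).aestronglyMeasurable]

theorem integral_lin_signedProblem (h : ∀ i, |ρ i| ≤ 1) :
    ∫ z, z.2 ∂signedProblem H v r ρ = ∑ i, (r i * ρ i) • v i := by
  have := fun i => isProbabilityMeasure_coin (h i)
  rw [signedProblem, integral_map measurable_signedObs.aemeasurable
    measurable_snd.aestronglyMeasurable]
  simp only [signedObs]
  rw [integral_finsetSum _ fun i _ => Integrable.of_finite]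
  refine Finset.sum_congr rfl fun i _ => ?_
  rw [integral_smul_const, integral_const_mul, integral_sgn_pi h]

theorem mulE_sum_smul (h : IsEigenDecomposition H v lam) (θ : Fin d → ℝ) :
    mulE H (∑ i, θ i • v i) = ∑ i, (lam i * θ i) • v i := by
  change mulELin H _ = _
  rw [map_sum]
  refine Finset.sum_congr rfl fun i _ => ?_
  rw [map_smul]
  change θ i • mulE H (v i) = _
  rw [h.eigen, smul_smul, mul_comm]

theorem inner_sum_smul (θ : Fin d → ℝ) (i : Fin d) :
    inner ℝ (v i) (∑ j, θ j • v j) = θ i := by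
  simp [inner_sum, inner_smul_right, v.inner_eq_ite]

/-- The hypothesis on `θ` is the normal equation in eigencoordinates, written without division so
that zero eigenvalues are allowed. -/
theorem stationary_signedProblem (hd : IsEigenDecomposition H v lam) (h : ∀ i, |ρ i| ≤ 1)
    {θ : Fin d → ℝ} (hθ : ∀ i, r i * ρ i = lam i * θ i) :
    mulE H (∑ i, θ i • v i) = ∫ z, z.2 ∂signedProblem H v r ρ := by
  rw [mulE_sum_smul hd, integral_lin_signedProblem h]
  simp only [hθ]

theorem measurable_stochGrad (w : E d) : Measurable fun z : Obs d => stochGrad w z :=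
  (measurable_mulE_fst w).sub measurable_snd

/-- With a deterministic Hessian the gradient noise is the negative of the centred linear part,
whatever `w` is. Its eigencoordinates are independent with variances at most `r i ^ 2 = σ ^ 2 * lam
i`, so variances along `u` add up to at most `σ² uᵀ H u`. -/
theorem noise_signedProblem (hd : IsEigenDecomposition H v lam) (h : ∀ i, |ρ i| ≤ 1) {σ : ℝ}
    (hr : ∀ i, r i ^ 2 = σ ^ 2 * lam i) : InNoiseClass H σ (signedProblem H v r ρ) := by
  intro w u
  have := fun i => isProbabilityMeasure_coin (h i)
  have := isProbabilityMeasure_signedProblem (H := H) (v := v) (r := r) h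
  set a : Fin d → ℝ := fun i => inner ℝ u (v i) * r i with ha
  set X : (Fin d → Bool) → ℝ := ∑ i, fun y => a i * sgn (y i) with hX
  have hXapp : ∀ y, X y = ∑ i, a i * sgn (y i) := fun y => by rw [hX, Finset.sum_apply]
  have hXmean : ∫ y, X y ∂(Measure.pi fun j => coin (ρ j)) = ∑ i, a i * ρ i := by
    simp only [hXapp]
    rw [integral_finsetSum _ fun i _ => Integrable.of_finite]
    exact Finset.sum_congr rfl fun i _ => by rw [integral_const_mul, integral_sgn_pi h]
  have hgrad : ∫ z, stochGrad w z ∂signedProblem H v r ρ =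
      mulE H w - ∑ i, (r i * ρ i) • v i := by
    have hi : ∀ i j, Integrable (fun z : Obs d => z.1 i j) (signedProblem H v r ρ) := fun i j =>
      integrable_signedProblem h (measurable_hess_apply i j)
    simp only [stochGrad]
    rw [integral_sub (integrable_mulE hi w) (integrable_signedProblem h measurable_snd),
      integral_mulE hi (integral_hess_signedProblem h), integral_lin_signedProblem h]
  have hdev : ∀ y, inner ℝ u (stochGrad w (signedObs H v r y) -
      ∫ z, stochGrad w z ∂signedProblem H v r ρ) ^ 2 =
      (X y - ∫ y, X y ∂(Measure.pi fun j => coin (ρ j))) ^ 2 := fun y => by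
    rw [hgrad, hXmean, hXapp, stochGrad, signedObs, ← neg_sq]
    congr 1
    have hsum : ∀ b : Fin d → ℝ, inner ℝ u (∑ i, (r i * b i) • v i) = ∑ i, a i * b i := fun b => by
      rw [inner_sum]
      refine Finset.sum_congr rfl fun i _ => ?_
      rw [inner_smul_right, ha]; ring
    rw [inner_sub_right, inner_sub_right, inner_sub_right, hsum, hsum]
    ring
  have hmap := lintegral_map (μ := Measure.pi fun j => coin (ρ j))
    (measurable_ofReal_inner_sub_sq u (∫ z, stochGrad w z ∂signedProblem H v r ρ)
      (measurable_stochGrad w)) (measurable_signedObs (H := H) (v := v) (r := r))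
  simp only [hdev] at hmap
  refine hmap.le.trans ?_
  rw [← ProbabilityTheory.evariance_eq_lintegral_ofReal X,
    ← ProbabilityTheory.ofReal_variance MemLp.of_discrete]
  refine ENNReal.ofReal_le_ofReal ?_
  rw [hX, ProbabilityTheory.variance_sum_pi (X := fun i b => a i * sgn b)
    fun i => MemLp.of_discrete, hd.quadratic_eq_sum, Finset.mul_sum]
  refine Finset.sum_le_sum fun i _ => (variance_mul_sgn_coin_le (h i) (a i)).trans (le_of_eq ?_)
  rw [ha, mul_pow, hr, real_inner_comm]
  ring

theorem signedProblem_mem (hd : IsEigenDecomposition H v lam) (h : ∀ i, |ρ i| ≤ 1) {σ c : ℝ}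
    (hr : ∀ i, r i ^ 2 = σ ^ 2 * lam i) {θ : Fin d → ℝ} (hθ : ∀ i, r i * ρ i = lam i * θ i)
    (hc : ∀ i, |θ i| ≤ c) : signedProblem H v r ρ ∈ problemClass H v (fun _ => c) σ := by
  have hi : ∀ i j, Integrable (fun z : Obs d => z.1 i j) (signedProblem H v r ρ) := fun i j =>
    integrable_signedProblem h (measurable_hess_apply i j)
  have hb : Integrable (fun z : Obs d => z.2) (signedProblem H v r ρ) :=
    integrable_signedProblem h measurable_snd
  have hH := integral_hess_signedProblem (H := H) (v := v) (r := r) h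
  refine ⟨⟨isProbabilityMeasure_signedProblem h, ?_, hi, hb, hH, ∑ i, θ i • v i, ?_, fun i => ?_⟩,
    noise_signedProblem hd h hr⟩
  -- Passing through entrywise equality gives measurable events, as the transfer along the map
  -- requires.
  · have hconst : ∀ᵐ z ∂signedProblem H v r ρ, ∀ i j, z.1 i j = H i j := by
      refine ae_all_iff.2 fun i => ae_all_iff.2 fun j => ?_
      rw [signedProblem, ae_map_iff measurable_signedObs.aemeasurable
        (measurableSet_eq_fun (measurable_hess_apply i j) measurable_const)]
      exact Filter.Eventually.of_forall fun y => rfl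
    filter_upwards [hconst] with z hz
    have : z.1 = H := Matrix.ext hz
    rw [this]
    exact hd.posSemidef
  · exact objective_le_of_stationary hd hi hb hH (stationary_signedProblem hd h hθ)
  · rw [inner_sum_smul]
    exact hc i

/-- The law of `T` draws from `signedProblem` as a finite sum. -/
theorem lintegral_pi_signedProblem {T : ℕ} (h : ∀ i, |ρ i| ≤ 1) {F : (Fin T → Obs d) → ℝ≥0∞}
    (hF : Measurable F) :
    ∫⁻ x, F x ∂(Measure.pi fun _ => signedProblem H v r ρ) =
      ∑ y : Fin T → Fin d → Bool,
        ENNReal.ofReal (drawWeight ρ y) * F (fun t => signedObs H v r (y t)) := by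
  have := fun i => isProbabilityMeasure_coin (h i)
  have := isProbabilityMeasure_signedProblem (H := H) (v := v) (r := r) h
  have hmap := Measure.pi_map_pi (ι := Fin T) (μ := fun _ => Measure.pi fun i => coin (ρ i))
    (f := fun _ => signedObs H v r) (hμ := fun _ => by
      change SigmaFinite (signedProblem H v r ρ); infer_instance)
    fun _ => measurable_signedObs.aemeasurable
  simp only [signedProblem]
  rw [← hmap, lintegral_map hF (measurable_of_finite _), lintegral_fintype]
  refine Finset.sum_congr rfl fun y _ => ?_
  rw [mul_comm]
  congr 1
  simp only [Measure.pi_singleton, coin_singleton, drawWeight]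
  rw [ENNReal.ofReal_prod_of_nonneg fun t _ => Finset.prod_nonneg fun i _ =>
    coinWeight_nonneg (h i) _]
  refine Finset.prod_congr rfl fun t _ => ?_
  rw [ENNReal.ofReal_prod_of_nonneg fun i _ => coinWeight_nonneg (h i) _]

end HardProblem

/-! ### The minimax lower bound -/

section LowerBound

variable {d T : ℕ} {H : Matrix (Fin d) (Fin d) ℝ} {v : OrthonormalBasis (Fin d) ℝ (E d)}
  {lam r ρ δ : Fin d → ℝ} {c σ : ℝ}

/-- The risk of an algorithm on `signedProblem`: conditionally on the seeds, a finite sum. -/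
theorem excessRisk_signedProblem (A : Algorithm d T) (hd : IsEigenDecomposition H v lam)
    (h : ∀ i, |ρ i| ≤ 1) (hδ : ∀ i, r i * ρ i = lam i * δ i) :
    (Measurable fun s => ∑ y : Fin T → Fin d → Bool, ENNReal.ofReal (drawWeight ρ y *
        (1 / 2 * ∑ i, lam i *
          (inner ℝ (v i) (A.output s fun t => signedObs H v r (y t)) - δ i) ^ 2))) ∧
      A.excessRisk (signedProblem H v r ρ) =
        ∫⁻ s, ∑ y : Fin T → Fin d → Bool, ENNReal.ofReal (drawWeight ρ y *
          (1 / 2 * ∑ i, lam i *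
            (inner ℝ (v i) (A.output s fun t => signedObs H v r (y t)) - δ i) ^ 2)) ∂A.seedLaw := by
  have := isProbabilityMeasure_signedProblem (H := H) (v := v) (r := r) h
  have := A.isProbability
  have hout : Measurable fun p : (Fin T → E d) × (Fin T → Obs d) => A.output p.1 p.2 :=
    A.measurable_iterate T le_rfl
  have hcont : Continuous fun w : E d => 1 / 2 * ∑ i, lam i * (inner ℝ (v i) w - δ i) ^ 2 := by
    fun_prop
  have hloss := ENNReal.measurable_ofReal.comp (hcont.measurable.comp hout)
  have hw := drawWeight_nonneg (T := T) h
  refine ⟨Finset.measurable_sum _ fun y _ => ?_, ?_⟩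
  · exact ENNReal.measurable_ofReal.comp
      ((hcont.measurable.comp (hout.comp measurable_prodMk_right)).const_mul _)
  have hobj : ∀ w, objective (signedProblem H v r ρ) w - ⨅ w', objective (signedProblem H v r ρ) w' =
      1 / 2 * ∑ i, lam i * (inner ℝ (v i) w - δ i) ^ 2 := fun w => by
    rw [objective_sub_iInf hd
      (fun i j => integrable_signedProblem h (measurable_hess_apply i j))
      (integrable_signedProblem h measurable_snd) (integral_hess_signedProblem h)
      (stationary_signedProblem hd h hδ)]
    simp only [inner_sub_right, inner_sum_smul]
  rw [Algorithm.excessRisk, Algorithm.jointLaw]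
  simp only [hobj]
  refine (lintegral_prod _ hloss.aemeasurable).trans (lintegral_congr fun s => ?_)
  refine (lintegral_pi_signedProblem h (hloss.comp measurable_prodMk_left)).trans ?_
  exact Finset.sum_congr rfl fun y _ => (ENNReal.ofReal_mul (hw y)).symm

/-- Assouad's bound for the minimax risk. -/
theorem le_minimaxRisk_of_signed (hd : IsEigenDecomposition H v lam) (h : ∀ i, |ρ i| ≤ 1)
    (hr : ∀ i, r i ^ 2 = σ ^ 2 * lam i) (hδ : ∀ i, r i * ρ i = lam i * δ i)
    (hc : ∀ i, |δ i| ≤ c) :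
    ENNReal.ofReal (∑ i, 1 / 2 * (lam i * (δ i ^ 2 * (1 - ρ i ^ 2) ^ T))) ≤
      minimaxRisk T (problemClass H v (fun _ => c) σ) := by
  refine le_iInf fun A => ?_
  have := A.isProbability
  have habs : ∀ (τ : Fin d → Bool) j, |ρ j * sgn (τ j)| ≤ 1 := fun τ j => by
    rw [abs_mul, abs_sgn, mul_one]; exact h j
  have hδτ : ∀ (τ : Fin d → Bool) i, r i * (ρ i * sgn (τ i)) = lam i * (sgn (τ i) * δ i) :=
    fun τ i => by linear_combination sgn (τ i) * hδ i
  have hcτ : ∀ (τ : Fin d → Bool) i, |sgn (τ i) * δ i| ≤ c := fun τ i => by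
    rw [abs_mul, abs_sgn, one_mul]; exact hc i
  set S := ⨆ μ ∈ problemClass H v (fun _ => c) σ, A.excessRisk μ with hS
  have hle : ∀ τ : Fin d → Bool, A.excessRisk (signedProblem H v r fun j => ρ j * sgn (τ j)) ≤ S :=
    fun τ => le_iSup₂ (f := fun μ _ => A.excessRisk μ) _
      (signedProblem_mem hd (habs τ) hr (hδτ τ) (hcτ τ))
  have hsum : ENNReal.ofReal (2 ^ d * ∑ i, 1 / 2 * (lam i * (δ i ^ 2 * (1 - ρ i ^ 2) ^ T))) ≤
      ∑ τ : Fin d → Bool, A.excessRisk (signedProblem H v r fun j => ρ j * sgn (τ j)) := by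
    -- The seed law is the same for all sign vectors, so their sum moves inside the seed integral;
    -- for fixed seeds the output is a deterministic function of the data and `assouad` applies.
    rw [Finset.sum_congr rfl fun τ _ => (excessRisk_signedProblem A hd (habs τ) (hδτ τ)).2,
      ← lintegral_finsetSum _ fun τ _ => (excessRisk_signedProblem A hd (habs τ) (hδτ τ)).1]
    calc _ = ∫⁻ _s, ENNReal.ofReal
          (2 ^ d * ∑ i, 1 / 2 * (lam i * (δ i ^ 2 * (1 - ρ i ^ 2) ^ T))) ∂A.seedLaw := by simp
      _ ≤ _ := lintegral_mono fun s => by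
        have hl := hd.lam_nonneg
        have hnn : ∀ (τ : Fin d → Bool) (y : Fin T → Fin d → Bool),
            0 ≤ drawWeight (fun j => ρ j * sgn (τ j)) y * (1 / 2 * ∑ i, lam i *
              (inner ℝ (v i) (A.output s fun t => signedObs H v r (y t)) - sgn (τ i) * δ i) ^ 2) :=
          fun τ y => mul_nonneg (drawWeight_nonneg (habs τ) y) (mul_nonneg (by norm_num)
            (Finset.sum_nonneg fun i _ => mul_nonneg (hl i) (sq_nonneg _)))
        simp only [← ENNReal.ofReal_sum_of_nonneg fun y _ => hnn _ y]
        rw [← ENNReal.ofReal_sum_of_nonneg fun τ _ => Finset.sum_nonneg fun y _ => hnn τ y]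
        exact ENNReal.ofReal_le_ofReal (assouad h hl
          (fun y i => inner ℝ (v i) (A.output s fun t => signedObs H v r (y t))) δ)
  -- The supremum dominates the average over the `2 ^ d` sign vectors.
  have hS2 : ∑ τ : Fin d → Bool, A.excessRisk (signedProblem H v r fun j => ρ j * sgn (τ j)) ≤
      2 ^ d * S := by
    refine (Finset.sum_le_sum fun τ _ => hle τ).trans (le_of_eq ?_)
    simp
  have htot := hsum.trans hS2
  rw [ENNReal.ofReal_mul (by positivity), ENNReal.ofReal_pow (by norm_num),
    ENNReal.ofReal_ofNat] at htot
  exact (ENNReal.mul_le_mul_iff_right (by simp) (by simp)).1 htot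

/-- The lower bound for the minimax risk. -/
theorem minimaxRate_le_minimaxRisk (hc : 0 < c) (hσ : 0 ≤ σ) (hT : 1 ≤ T)
    (hd : IsEigenDecomposition H v lam) :
    ENNReal.ofReal (1 / 8 * minimaxRate lam T c σ) ≤
      minimaxRisk T (problemClass H v (fun _ => c) σ) := by
  have hl := hd.lam_nonneg
  have hT0 : (0 : ℝ) < T := by exact_mod_cast hT
  have hT1 : (1 : ℝ) ≤ T := by exact_mod_cast hT
  -- For `σ = 0` the threshold is 0, so every coordinate is in the head and contributes 0.
  rcases hσ.eq_or_lt with rfl | hσ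
  · rw [minimaxRate_eq_sum hd.antitone]
    simp [hl]
  -- The largest separation allowed by `|δ i| ≤ c` and `ρ i ^ 2 ≤ 1 / (2 * T)`. Division by zero
  -- makes `δ i = 0` when `lam i = 0`. The value of `ρ` is forced by `r i * ρ i = lam i * δ i` with
  -- `r i = σ * √(lam i)`.
  set δ : Fin d → ℝ := fun i => √(min (c ^ 2) (σ ^ 2 / (2 * T * lam i))) with hδ
  set ρ : Fin d → ℝ := fun i => √(lam i) * δ i / σ with hρ
  have hδ2 : ∀ i, δ i ^ 2 = min (c ^ 2) (σ ^ 2 / (2 * T * lam i)) := fun i =>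
    Real.sq_sqrt (le_min (sq_nonneg c) (by have := hl i; positivity))
  have hδc : ∀ i, |δ i| ≤ c := fun i =>
    abs_le_of_sq_le_sq ((hδ2 i).trans_le (min_le_left _ _)) hc.le
  have hρ2 : ∀ i, ρ i ^ 2 = lam i * δ i ^ 2 / σ ^ 2 := fun i => by
    rw [hρ, div_pow, mul_pow, Real.sq_sqrt (hl i)]
  have hlδ : ∀ i, lam i * δ i ^ 2 = min (lam i * c ^ 2) (σ ^ 2 / (2 * T)) ∨ lam i = 0 := fun i => by
    rcases (hl i).eq_or_lt with h0 | h0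
    · exact Or.inr h0.symm
    · left
      rw [hδ2, mul_min_of_nonneg _ _ h0.le]
      congr 1
      field_simp
  have hρT : ∀ i, ρ i ^ 2 ≤ 1 / (2 * T) := fun i => by
    rw [hρ2]
    rcases hlδ i with h | h
    · rw [h, div_le_iff₀ (by positivity)]
      refine (min_le_right _ _).trans (le_of_eq ?_)
      ring
    · rw [h]; simp
  have hρ1 : ∀ i, |ρ i| ≤ 1 := fun i => by
    refine (sq_le_one_iff_abs_le_one _).1 ((hρT i).trans ?_)
    rw [div_le_one (by positivity)]; linarith
  have haff : ∀ i, 1 / 2 ≤ (1 - ρ i ^ 2) ^ T := fun i => by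
    -- Bernoulli's inequality: `(1 - ρ²)^T ≥ 1 - T ρ² ≥ 1/2`.
    have hb := one_add_mul_le_pow (show -2 ≤ -ρ i ^ 2 by
      have := (sq_le_one_iff_abs_le_one _).2 (hρ1 i); linarith) T
    have h2 : (T : ℝ) * ρ i ^ 2 ≤ 1 / 2 := by
      calc (T : ℝ) * ρ i ^ 2 ≤ T * (1 / (2 * T)) := by gcongr; exact hρT i
        _ = 1 / 2 := by field_simp
    rw [← sub_eq_add_neg] at hb
    linarith
  refine le_trans (ENNReal.ofReal_le_ofReal ?_) (le_minimaxRisk_of_signed (r := fun i => σ * √(lam i))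
    (ρ := ρ) (δ := δ) hd hρ1 (fun i => by rw [mul_pow, Real.sq_sqrt (hl i)]) (fun i => by
      rw [hρ]
      have := Real.mul_self_sqrt (hl i)
      field_simp
      linear_combination δ i * this) hδc)
  rw [minimaxRate_eq_sum hd.antitone, Finset.mul_sum]
  refine Finset.sum_le_sum fun i _ => ?_
  have hli := hl i
  have hstep : 1 / 4 * (lam i * δ i ^ 2) ≤ 1 / 2 * (lam i * (δ i ^ 2 * (1 - ρ i ^ 2) ^ T)) := by
    have := mul_le_mul_of_nonneg_left (haff i) (show 0 ≤ lam i * δ i ^ 2 by positivity)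
    linarith
  refine le_trans ?_ hstep
  -- Halving only one argument of the minimum costs at most a factor 2, which turns `1/4` into
  -- `1/8`; the threshold decides which argument of `min (lam i * c ^ 2) (σ ^ 2 / T)` is smaller.
  have hhalf : σ ^ 2 / (2 * T) = σ ^ 2 / T / 2 := by ring
  rcases hlδ i with h | h
  · rw [h, hhalf]
    split_ifs with hi
    · rw [div_le_iff₀ (by positivity)] at hi
      have : σ ^ 2 / T ≤ lam i * c ^ 2 := by
        rw [div_le_iff₀ hT0]; linarith
      have h0 : 0 ≤ σ ^ 2 / T := by positivity
      rw [min_eq_right (by linarith)]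
      linarith
    · rw [not_le, lt_div_iff₀ (by positivity)] at hi
      have : lam i * c ^ 2 ≤ σ ^ 2 / T := by
        rw [le_div_iff₀ hT0]; linarith
      have h0 : 0 ≤ lam i * c ^ 2 := by positivity
      have : lam i * c ^ 2 / 2 ≤ min (lam i * c ^ 2) (σ ^ 2 / T / 2) :=
        le_min (by linarith) (by linarith)
      linarith
  · have hi : ¬ σ ^ 2 / (T * c ^ 2) ≤ lam i := by
      rw [h, not_le]; positivity
    rw [if_neg hi, h]
    simp

end LowerBound

end StochQuad

/-! ### The three claims assembled -/

theorem mainTheorem4 :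
    -- upper bound for SGD, with a constant that depends only on `c` and `η₀`
    (∀ c η₀ : ℝ, 0 < c → 0 < η₀ → ∃ C : ℝ, 0 < C ∧
      ∀ (d T : ℕ) (σ : ℝ) (H : Matrix (Fin d) (Fin d) ℝ)
        (v : OrthonormalBasis (Fin d) ℝ (StochQuad.E d)) (lam : Fin d → ℝ)
        (μ : MeasureTheory.Measure (StochQuad.Obs d)),
        16 ≤ T → 0 ≤ σ → StochQuad.IsEigenDecomposition H v lam → (∀ i, η₀ * lam i ≤ 1) →
        StochQuad.InOptimumClass H v (fun _ => c) μ →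
        (StochQuad.sgd d T η₀).GradientNoise H σ μ →
        (StochQuad.sgd d T η₀).excessRisk μ ≤ ENNReal.ofReal (C * ((1 + σ ^ 2) *
          (StochQuad.effDim lam (1 / T) * Real.logb 2 T ^ 4 / T +
            Real.logb 2 T ^ 2 * (StochQuad.tailSum lam (StochQuad.effDim lam (1 / T)) * c ^ 2))))) ∧
    -- lower bound for all algorithms
    (∀ (c σ : ℝ) (d T : ℕ) (H : Matrix (Fin d) (Fin d) ℝ)
        (v : OrthonormalBasis (Fin d) ℝ (StochQuad.E d)) (lam : Fin d → ℝ),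
        0 < c → 0 ≤ σ → 1 ≤ T → StochQuad.IsEigenDecomposition H v lam →
        ENNReal.ofReal (1 / 8 *
          (StochQuad.effDim lam (σ ^ 2 / (T * c ^ 2)) * σ ^ 2 / T +
            StochQuad.tailSum lam (StochQuad.effDim lam (σ ^ 2 / (T * c ^ 2))) * c ^ 2)) ≤
          StochQuad.minimaxRisk T (StochQuad.problemClass H v (fun _ => c) σ)) ∧
    -- SGD attains the min-max rate for every Hessian, up to the factor `C (log₂ T)^4`
    (∀ c σ η₀ : ℝ, 0 < c → 0 < σ → 0 < η₀ → ∃ C : ℝ, 0 < C ∧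
      ∀ (d T : ℕ) (H : Matrix (Fin d) (Fin d) ℝ)
        (v : OrthonormalBasis (Fin d) ℝ (StochQuad.E d)) (lam : Fin d → ℝ),
        16 ≤ T → StochQuad.IsEigenDecomposition H v lam → (∀ i, η₀ * lam i ≤ 1) →
        (⨆ μ ∈ StochQuad.problemClass H v (fun _ => c) σ,
            (StochQuad.sgd d T η₀).excessRisk μ) ≤
          ENNReal.ofReal (C * Real.logb 2 T ^ 4) *
            StochQuad.minimaxRisk T (StochQuad.problemClass H v (fun _ => c) σ)) := by
  have hpos : ∀ c η₀ : ℝ, 0 < c → 0 < η₀ → 0 < c ^ 2 / η₀ + 32 + 1 + η₀ ^ 2 / c ^ 2 :=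
    fun c η₀ hc hη => by positivity
  refine ⟨fun c η₀ hc hη => ⟨_, hpos c η₀ hc hη, ?_⟩, ?_, fun c σ η₀ hc hσ hη => ?_⟩
  · intro d T σ H v lam μ hT _ hd h1 hμ hn
    exact StochQuad.sgd_excessRisk_le_rate hc hη hT hd h1 hμ hn
  · intro c σ d T H v lam hc hσ hT hd
    exact StochQuad.minimaxRate_le_minimaxRisk hc hσ hT hd
  · set C₁ := c ^ 2 / η₀ + 32 + 1 + η₀ ^ 2 / c ^ 2 with hC₁
    set C₂ := 1 + 1 / σ ^ 2 + 1 / c ^ 2 + c ^ 2 / σ ^ 2 with hC₂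
    have hp₁ : 0 < C₁ := hpos c η₀ hc hη
    have hp₂ : 0 < C₂ := by positivity
    -- `C₁ (1 + σ²)` comes from the SGD bound, `C₂` from comparing the rates, and 8 undoes the `1/8`
    -- of the lower bound.
    refine ⟨8 * C₁ * (1 + σ ^ 2) * C₂, by positivity, fun d T H v lam hT hd h1 => ?_⟩
    refine iSup₂_le fun μ hμ => ?_
    have hrate := StochQuad.sgdRate_le_minimaxRate hc hσ hT hd.antitone hd.lam_nonneg
    rw [← hC₂] at hrate
    calc (StochQuad.sgd d T η₀).excessRisk μ
        ≤ ENNReal.ofReal (C₁ * ((1 + σ ^ 2) * StochQuad.sgdRate lam T c)) :=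
          -- The noise class bounds the variance at every point, in particular at every iterate.
          StochQuad.sgd_excessRisk_le_rate hc hη hT hd h1 hμ.1 fun t ht =>
            Filter.Eventually.of_forall fun p => hμ.2 _
      _ ≤ ENNReal.ofReal (8 * C₁ * (1 + σ ^ 2) * C₂ * Real.logb 2 T ^ 4 *
            (1 / 8 * StochQuad.minimaxRate lam T c σ)) := by
          refine ENNReal.ofReal_le_ofReal ?_
          calc C₁ * ((1 + σ ^ 2) * StochQuad.sgdRate lam T c)
              ≤ C₁ * ((1 + σ ^ 2) *
                (C₂ * Real.logb 2 T ^ 4 * StochQuad.minimaxRate lam T c σ)) := by gcongr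
            _ = _ := by ring
      _ ≤ _ := by
          rw [ENNReal.ofReal_mul (by have := StochQuad.one_le_logb hT; positivity)]
          gcongr
          exact StochQuad.minimaxRate_le_minimaxRisk hc hσ.le (by omega) hd
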